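/- Let $K=\mathbb R$ or $K=\mathbb C$, and let $E$ be a finite-dimensional $K$-vector space with a non-degenerate symmetric bilinear form $b$. Let $O(E,b)$ be its isometry group, and let $\mathrm{Cliff}(E,b)$ be the Clifford algebra with relations $xy+yx=b(x,y)$ for $x,y\in E$. Let $\alpha$ be its grading involution and $\tau$ the anti-automorphism that reverses products of vectors. Let $\mathrm{Pin}(E,b)$ be the group of all invertible $x\in\mathrm{Cliff}(E,b)$ such that $\alpha(x)\,E\,x^{-1}=E$ and $x\,\tau(\alpha(x))\in\{1,-1\}$ if $K=\mathbb R$, respectively $x\,\tau(\alpha(x))=1$ if $K=\mathbb C$. Let $\pi:\mathrm{Pin}(E,b)\to O(E,b)$, $\pi(x)(e)=\alpha(x)\,e\,x^{-1}$, be the double covering. A pair $(H,H')$ of subgroups of a group $\Gamma$ is a *dual pair* if $Z_\Gamma(H')=H$ and $Z_\Gamma(H)=H'$. If $\Gamma=O(E,b)$ or $\Gamma=\mathrm{Pin}(E,b)$ (the latter acting on $E$ through $\pi$), a dual pair is *irreducible* if there is no orthogonal decomposition $E=E_1\oplus E_2$ into two nonzero subspaces, both invariant under $H$ and $H'$. A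 dual pair $(G,G')$ in $O(E,b)$ is *reductive* if each $G$-invariant subspace of $E$ has a $G$-invariant complement, and the same holds for $G'$. It is *$K$-orthogonal* if, up to isometry, $(E,b)=(V\otimes_K W,\,b_V\otimes b_W)$ with $b_V$, $b_W$ non-degenerate symmetric $K$-bilinear forms on finite-dimensional $K$-vector spaces $V$, $W$, and $G=O(V,b_V)$, $G'=O(W,b_W)$ acting on the two factors. Let $(G,G')$ be an irreducible reductive dual pair in $O(E,b)$. 1. If $K=\mathbb R$ and $(G,G')$ is not $\mathbb R$-orthogonal, then $(\pi^{-1}(G),\pi^{-1}(G'))$ is an irreducible dual pair in $\mathrm{Pin}(E,b)$. 2. If $K=\mathbb C$ and either $(G,G')$ is not $\mathbb C$-orthogonal or $\dim_{\mathbb C}E$ is odd (that is, $(G,G')=(O(n,\mathbb C),O(m,\mathbb C))$ with $n$ and $m$ odd), then $(\pi^{-1}(G),\pi^{-1}(G'))$ is an irreducible dual pair in $\mathrm{Pin}(E,b)$. -/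

import Mathlib

namespace PinDualPair

open CliffordAlgebra

set_option linter.unusedSectionVars false

section Definitions

variable {K E : Type*} [Field K] [CharZero K] [AddCommGroup E] [Module K E]

/-- The group `O(E, b)` of isometries of a bilinear form. -/
def orthogonalGroup (b : LinearMap.BilinForm K E) : Subgroup (E ≃ₗ[K] E) where
  carrier := {g | ∀ u v, b (g u) (g v) = b u v}
  mul_mem' := fun {g h} hg hh u v => by
    change b (g (h u)) (g (h v)) = b u v
    rw [hg, hh]
  one_mem' := fun _ _ => rfl
  inv_mem' := fun {g} hg u v => by
    have h := hg (g⁻¹ u) (g⁻¹ v)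
    rw [← h]
    congr 2
    · exact g.apply_symm_apply u
    · exact g.apply_symm_apply v

/-- The quadratic form `v ↦ b(v, v) / 2`. In its Clifford algebra `x y + y x = b(x, y)` for
vectors `x`, `y`. -/
noncomputable def halfQuadraticForm (b : LinearMap.BilinForm K E) : QuadraticForm K E :=
  (2⁻¹ : K) • LinearMap.BilinMap.toQuadraticMap b

theorem halfQuadraticForm_apply (b : LinearMap.BilinForm K E) (v : E) :
    halfQuadraticForm b v = 2⁻¹ * b v v := rfl

/-- The defining relation `x y + y x = b(x, y)` of `Cliff(E, b)`. -/
theorem ι_mul_ι_add_swap_eq (b : LinearMap.BilinForm K E) (hb : b.IsSymm) (x y : E) :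
    ι (halfQuadraticForm b) x * ι (halfQuadraticForm b) y
      + ι (halfQuadraticForm b) y * ι (halfQuadraticForm b) x
      = algebraMap K (CliffordAlgebra (halfQuadraticForm b)) (b x y) := by
  rw [ι_mul_ι_add_swap]
  congr 1
  simp only [QuadraticMap.polar, halfQuadraticForm_apply, map_add, LinearMap.add_apply]
  rw [hb.eq y x]
  ring

theorem ι_injective (Q : QuadraticForm K E) : Function.Injective (ι Q) := by
  let _ : Invertible (2 : K) := invertibleOfNonzero two_ne_zero
  intro x y h
  have h' := congrArg (equivExterior Q) h
  simp only [equivExterior, changeFormEquiv_apply, changeForm_ι] at h'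
  exact ExteriorAlgebra.ι_leftInverse.injective h'

/-- The Pin group with spinor norms in `S`: the invertible `x` in `Cliff(E, b)` with
`x τ(α(x)) ∈ S` and `α(x) E x⁻¹ = E`, where `α` is the grading involution and `τ` is the
antiautomorphism reversing products of vectors. -/
def pin (b : LinearMap.BilinForm K E) (S : Subgroup Kˣ) :
    Subgroup (CliffordAlgebra (halfQuadraticForm b))ˣ where
  carrier := {x |
    (∃ c ∈ S, (x : CliffordAlgebra (halfQuadraticForm b)) *
      reverse (involute (x : CliffordAlgebra (halfQuadraticForm b)))
        = algebraMap K _ (c : K)) ∧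
    (fun y => involute (x : CliffordAlgebra (halfQuadraticForm b)) * y *
      ((x⁻¹ : (CliffordAlgebra (halfQuadraticForm b))ˣ) : CliffordAlgebra (halfQuadraticForm b)))
        '' Set.range (ι (halfQuadraticForm b)) = Set.range (ι (halfQuadraticForm b))}
  mul_mem' := by
    rintro x y ⟨⟨c, hc, hxc⟩, hx⟩ ⟨⟨d, hd, hyd⟩, hy⟩
    refine ⟨⟨c * d, S.mul_mem hc hd, ?_⟩, ?_⟩
    · rw [Units.val_mul, map_mul, reverse.map_mul, mul_assoc,
        ← mul_assoc (y : CliffordAlgebra (halfQuadraticForm b)), hyd,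
        Algebra.commutes, ← mul_assoc, hxc, Units.val_mul, map_mul]
    · conv_rhs => rw [← hx, ← hy, Set.image_image]
      refine Set.image_congr fun z _ => ?_
      simp only [Units.val_mul, map_mul, mul_inv_rev, mul_assoc]
  one_mem' := by
    refine ⟨⟨1, S.one_mem, ?_⟩, ?_⟩
    · simp
    · simp
  inv_mem' := by
    rintro x ⟨⟨c, hc, hxc⟩, hx⟩
    refine ⟨⟨c⁻¹, S.inv_mem hc, ?_⟩, ?_⟩
    · set R : CliffordAlgebra (halfQuadraticForm b) →
        CliffordAlgebra (halfQuadraticForm b) := fun z => reverse (involute z) with hR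
      have hRmul : ∀ z w, R (z * w) = R w * R z := fun z w => by
        simp only [hR, map_mul, reverse.map_mul]
      have h1 : R (x : _) * R ((x⁻¹ : (CliffordAlgebra (halfQuadraticForm b))ˣ) : _) = 1 := by
        rw [← hRmul, Units.inv_mul]
        simp [hR]
      have h2 : R (x : _) = ((x⁻¹ : (CliffordAlgebra (halfQuadraticForm b))ˣ) :
          CliffordAlgebra (halfQuadraticForm b)) * algebraMap K _ (c : K) := by
        rw [← hxc, ← mul_assoc, Units.inv_mul, one_mul]
      have h3 : algebraMap K (CliffordAlgebra (halfQuadraticForm b)) ((c⁻¹ : Kˣ) : K) *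
          algebraMap K _ (c : K) = 1 := by
        rw [← map_mul, Units.inv_mul, map_one]
      change ((x⁻¹ : (CliffordAlgebra (halfQuadraticForm b))ˣ) : _) *
        R ((x⁻¹ : (CliffordAlgebra (halfQuadraticForm b))ˣ) : _) = _
      rw [h2, mul_assoc, Algebra.commutes] at h1
      calc _ = (algebraMap K (CliffordAlgebra (halfQuadraticForm b)) ((c⁻¹ : Kˣ) : K) *
            algebraMap K _ (c : K)) *
            (((x⁻¹ : (CliffordAlgebra (halfQuadraticForm b))ˣ) : _) *
            R ((x⁻¹ : (CliffordAlgebra (halfQuadraticForm b))ˣ) : _)) := by rw [h3, one_mul]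
        _ = algebraMap K (CliffordAlgebra (halfQuadraticForm b)) ((c⁻¹ : Kˣ) : K) := by
          rw [mul_assoc, Algebra.commutes (c : K), mul_assoc, h1, mul_one]
    · conv_lhs => rw [← hx, Set.image_image]
      have : ∀ z, involute ((x⁻¹ : (CliffordAlgebra (halfQuadraticForm b))ˣ) :
          CliffordAlgebra (halfQuadraticForm b)) *
          (involute (x : CliffordAlgebra (halfQuadraticForm b)) * z *
          ((x⁻¹ : (CliffordAlgebra (halfQuadraticForm b))ˣ) :
          CliffordAlgebra (halfQuadraticForm b))) * ((x⁻¹⁻¹ :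
          (CliffordAlgebra (halfQuadraticForm b))ˣ) : _) = z := fun z => by
        rw [inv_inv, mul_assoc, mul_assoc, Units.inv_mul, mul_one, ← mul_assoc, ← map_mul,
          Units.inv_mul, map_one, one_mul]
      simp only [this, Set.image_id']

theorem pin_exists (b : LinearMap.BilinForm K E) (S : Subgroup Kˣ) (x : pin b S) (e : E) :
    ∃ e' : E, ι (halfQuadraticForm b) e' =
      involute ((x : (CliffordAlgebra (halfQuadraticForm b))ˣ) :
        CliffordAlgebra (halfQuadraticForm b)) * ι (halfQuadraticForm b) e *
      (((x : (CliffordAlgebra (halfQuadraticForm b))ˣ)⁻¹ :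
        (CliffordAlgebra (halfQuadraticForm b))ˣ) : CliffordAlgebra (halfQuadraticForm b)) := by
  have h : _ ∈ Set.range (ι (halfQuadraticForm b)) :=
    x.2.2 ▸ Set.mem_image_of_mem _ (Set.mem_range_self e)
  exact h

/-- The vector `α(x) e x⁻¹`, for `x` in the Pin group. -/
noncomputable def pinAct (b : LinearMap.BilinForm K E) (S : Subgroup Kˣ) (x : pin b S) (e : E) :
    E :=
  (pin_exists b S x e).choose

theorem ι_pinAct (b : LinearMap.BilinForm K E) (S : Subgroup Kˣ) (x : pin b S) (e : E) :
    ι (halfQuadraticForm b) (pinAct b S x e) =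
      involute ((x : (CliffordAlgebra (halfQuadraticForm b))ˣ) :
        CliffordAlgebra (halfQuadraticForm b)) * ι (halfQuadraticForm b) e *
      (((x : (CliffordAlgebra (halfQuadraticForm b))ˣ)⁻¹ :
        (CliffordAlgebra (halfQuadraticForm b))ˣ) : CliffordAlgebra (halfQuadraticForm b)) :=
  (pin_exists b S x e).choose_spec

theorem pinAct_one (b : LinearMap.BilinForm K E) (S : Subgroup Kˣ) (e : E) :
    pinAct b S 1 e = e :=
  ι_injective _ (by rw [ι_pinAct]; simp)

theorem pinAct_mul (b : LinearMap.BilinForm K E) (S : Subgroup Kˣ) (x y : pin b S) (e : E) :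
    pinAct b S (x * y) e = pinAct b S x (pinAct b S y e) :=
  ι_injective _ (by
    rw [ι_pinAct, ι_pinAct, ι_pinAct]
    simp only [Subgroup.coe_mul, Units.val_mul, map_mul, mul_inv_rev, mul_assoc])

theorem pinAct_isometry (b : LinearMap.BilinForm K E) (hb : b.IsSymm) (S : Subgroup Kˣ)
    (x : pin b S) (u v : E) : b (pinAct b S x u) (pinAct b S x v) = b u v := by
  let _ : Invertible (2 : K) := invertibleOfNonzero two_ne_zero
  have key : ∀ e e' : E, ι (halfQuadraticForm b) (pinAct b S x e) *
      ι (halfQuadraticForm b) (pinAct b S x e') =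
      involute ((x : (CliffordAlgebra (halfQuadraticForm b))ˣ) :
        CliffordAlgebra (halfQuadraticForm b)) *
      (ι (halfQuadraticForm b) e * ι (halfQuadraticForm b) e') *
      involute (((x : (CliffordAlgebra (halfQuadraticForm b))ˣ)⁻¹ :
        (CliffordAlgebra (halfQuadraticForm b))ˣ) :
        CliffordAlgebra (halfQuadraticForm b)) := fun e e' => by
    have h := congrArg involute (ι_pinAct b S x e')
    rw [map_mul, map_mul, involute_ι, involute_ι, involute_involute, mul_neg, neg_mul,
      neg_inj] at h
    rw [h, ι_pinAct]
    simp only [mul_assoc, Units.inv_mul_cancel_left]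
  have h1 : algebraMap K (CliffordAlgebra (halfQuadraticForm b))
      (b (pinAct b S x u) (pinAct b S x v)) = algebraMap K _ (b u v) := by
    rw [← ι_mul_ι_add_swap_eq b hb, key, key, ← add_mul, ← mul_add, ι_mul_ι_add_swap_eq b hb,
      ← Algebra.commutes, mul_assoc, ← map_mul, Units.mul_inv, map_one, mul_one]
  have h2 := congrArg (equivExterior (halfQuadraticForm b)) h1
  simp only [equivExterior, changeFormEquiv_apply, changeForm_algebraMap] at h2
  exact (ExteriorAlgebra.algebraMap_leftInverse E).injective h2

/-- The projection `π : Pin(E, b) → O(E, b)`, `π(x)(e) = α(x) e x⁻¹`. -/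
noncomputable def pinProj (b : LinearMap.BilinForm K E) (hb : b.IsSymm) (S : Subgroup Kˣ) :
    pin b S →* orthogonalGroup b where
  toFun x :=
    ⟨{ toFun := pinAct b S x
       map_add' := fun u v => ι_injective (halfQuadraticForm b) (by
         simp only [map_add, ι_pinAct, mul_add, add_mul])
       map_smul' := fun c u => ι_injective (halfQuadraticForm b) (by
         simp only [map_smul, ι_pinAct, mul_smul_comm, smul_mul_assoc, RingHom.id_apply])
       invFun := pinAct b S x⁻¹
       left_inv := fun e => by rw [← pinAct_mul, inv_mul_cancel, pinAct_one]
       right_inv := fun e => by rw [← pinAct_mul, mul_inv_cancel, pinAct_one] },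
     pinAct_isometry b hb S x⟩
  map_one' := Subtype.ext (LinearEquiv.ext (pinAct_one b S))
  map_mul' x y := Subtype.ext (LinearEquiv.ext (pinAct_mul b S x y))

/-- `(H, H')` is a dual pair in the group `Γ`: each is the full centralizer of the other. -/
def IsDualPair {Γ : Type*} [Group Γ] (H H' : Subgroup Γ) : Prop :=
  Subgroup.centralizer (H' : Set Γ) = H ∧ Subgroup.centralizer (H : Set Γ) = H'

/-- The subspace `U` is invariant under `H`, acting on `E` through `ρ`. -/
def IsInvariant {b : LinearMap.BilinForm K E} {Γ : Type*} [Group Γ] (ρ : Γ →* orthogonalGroup b)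
    (H : Subgroup Γ) (U : Submodule K E) : Prop :=
  ∀ x ∈ H, ∀ u ∈ U, (ρ x : E ≃ₗ[K] E) u ∈ U

/-- `H` acts reductively on `E` through `ρ`: every invariant subspace has an invariant
complement. -/
def ActsReductively {b : LinearMap.BilinForm K E} {Γ : Type*} [Group Γ]
    (ρ : Γ →* orthogonalGroup b) (H : Subgroup Γ) : Prop :=
  ∀ U : Submodule K E, IsInvariant ρ H U → ∃ U' : Submodule K E, IsInvariant ρ H U' ∧ IsCompl U U'

/-- `E`, on which `Γ` acts through `ρ`, has no orthogonal decomposition `E = E₁ ⊕ E₂` into two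
nonzero subspaces that are both invariant under `H` and `H'`. -/
def IsIrreducible {b : LinearMap.BilinForm K E} {Γ : Type*} [Group Γ]
    (ρ : Γ →* orthogonalGroup b) (H H' : Subgroup Γ) : Prop :=
  ∀ E₁ E₂ : Submodule K E, IsCompl E₁ E₂ → (∀ u ∈ E₁, ∀ v ∈ E₂, b u v = 0) →
    IsInvariant ρ H E₁ → IsInvariant ρ H' E₁ → IsInvariant ρ H E₂ → IsInvariant ρ H' E₂ →
    E₁ = ⊥ ∨ E₂ = ⊥

/-- `(H, H')`, with `Γ` acting on `E` through `ρ`, is an irreducible dual pair in `Γ`. -/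
def IsIrreducibleDualPair {b : LinearMap.BilinForm K E} {Γ : Type*} [Group Γ]
    (ρ : Γ →* orthogonalGroup b) (H H' : Subgroup Γ) : Prop :=
  IsDualPair H H' ∧ IsIrreducible ρ H H'

/-- `(G, G')` is an irreducible reductive dual pair in `O(E, b)`. -/
def IsIrreducibleReductiveDualPair {b : LinearMap.BilinForm K E}
    (G G' : Subgroup (orthogonalGroup b)) : Prop :=
  IsIrreducibleDualPair (MonoidHom.id _) G G' ∧
    ActsReductively (MonoidHom.id _) G ∧ ActsReductively (MonoidHom.id _) G'

/-- `(G, G')` is of the form `(O(V, bV), O(W, bW))` over the ground field `K`: up to isometry,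
`E = V ⊗ W` with `b = bV ⊗ bW`, and `G`, `G'` are the groups `O(V, bV)`, `O(W, bW)` acting on the
two factors. -/
def IsOrthogonalPair {b : LinearMap.BilinForm K E} (G G' : Subgroup (orthogonalGroup b)) : Prop :=
  ∃ (n m : ℕ) (bV : LinearMap.BilinForm K (Fin n → K)) (bW : LinearMap.BilinForm K (Fin m → K))
    (φ : TensorProduct K (Fin n → K) (Fin m → K) ≃ₗ[K] E),
    bV.IsSymm ∧ bV.Nondegenerate ∧ bW.IsSymm ∧ bW.Nondegenerate ∧
    (∀ v w v' w', b (φ (v ⊗ₜ[K] w)) (φ (v' ⊗ₜ[K] w')) = bV v v' * bW w w') ∧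
    (∀ g : orthogonalGroup b, g ∈ G ↔
      ∃ a ∈ orthogonalGroup bV, ∀ v w, (g : E ≃ₗ[K] E) (φ (v ⊗ₜ[K] w)) = φ (a v ⊗ₜ[K] w)) ∧
    (∀ g : orthogonalGroup b, g ∈ G' ↔
      ∃ a ∈ orthogonalGroup bW, ∀ v w, (g : E ≃ₗ[K] E) (φ (v ⊗ₜ[K] w)) = φ (v ⊗ₜ[K] a w))

end Definitions

/-- The spinor norms allowed in the Pin group of a real space, `{1, -1}`. A vector `v` has spinor
norm `-b(v, v) / 2`, so for an indefinite form both signs are needed for `π` to be onto. -/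
def realNorms : Subgroup ℝˣ := Subgroup.zpowers (-1)

/-- The spinor norms allowed in the Pin group of a complex space, `{1}`. -/
def complexNorms : Subgroup ℂˣ := ⊥

end PinDualPair

/-!
The kernel of `π` consists of scalars and `π` is onto, so the preimages of `G` and `G'` form a dual
pair as soon as they commute (`isIrreducibleDualPair_comap`). The proof that they commute does not
use the classification of dual pairs. It combines a formula for the commutator of two lifts with an
analysis of the subspaces on which an element of `G` has determinant `-1`.

*The commutator of lifts.* Let `g` and `u` be commuting isometries with lifts `x` and `y`. They
commute up to a scalar. If `1 + u` is invertible, the scalar is `1`: the scalar part of an element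
of the Clifford algebra (its component of degree `0` in the exterior algebra) is a trace
(`scalarPart_mul_comm`), and it does not vanish on `y` (`Lifts.scalarPart_ne_zero`). Indeed, if `u`
is the Cayley transform of `a`, then the image `Y` of `y` in the exterior algebra satisfies
`b(f) ⌋ Y = 2 (a f) ∧ Y`, and a solution of such a system is determined by its scalar part
(`exterior_eq_zero_of_contractLeft`). In general, let `N` be the generalized eigenspace of `u` for
the eigenvalue `-1`, and split off from `u` the isometry that is `-1` on `N` and `1` on the
orthogonal complement. What remains has no eigenvalue `-1`, and a lift of the isometry split off
commutes with `x` when `det g = det (g|N) = 1`, because then `g` is an even product of reflections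
in vectors of `N` times an even product of reflections in vectors of the complement
(`commute_of_det_eq_one`).

*Determinants.* For `g ∈ G` and `u ∈ G'` the spaces `N` and `E` are nondegenerate and `G`-invariant.
Suppose that `g` has determinant `-1` on some such space. Since hyperbolic subspaces `X ⊕ X*`
contribute determinant `1`, a space of minimal dimension with this property is irreducible
(`exists_irreducible_det_ne_one`). Take it as `N` from now on. Its commutant is the ground field:
over `ℂ` by Schur's lemma, and over `ℝ` because an operator `J` with `J² = -1` that commutes with
`g` would make the determinant of `g` positive. Then the isotypic component of `N` is `N ⊗ Hom_G(N,
E)`, an orthogonal summand of `E` invariant under `G` and `G'`. By irreducibility it is `E`, and the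
pair is `(O(N), O(Hom_G(N, E)))` (`isOrthogonalPair_of_scalar_commutant`). So all determinants in
question are `1` if the pair is not orthogonal. If it is and `dim E` is odd, one can replace `g` by
`-g` to achieve `det g = 1`, since the lifts of `-1` are then central; and `det g = det (g|N) ^ m`
with `m = dim Hom_G(N, E)` odd rules out `det (g|N) = -1`.
-/

namespace PinDualPair

open CliffordAlgebra
open scoped TensorProduct

set_option linter.unusedSectionVars false

/-! ### First-order systems in the exterior algebra -/

section ExteriorAlgebra

variable {K E : Type*} [Field K] [AddCommGroup E] [Module K E]

/-- The Euler operator `x ↦ ∑ i, eᵢ ∧ (eᵢ* ⌋ x)` on the exterior algebra. -/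
noncomputable def eulerOperator {ι' : Type*} [Fintype ι'] (e : Module.Basis ι' K E) :
    ExteriorAlgebra K E →ₗ[K] ExteriorAlgebra K E :=
  ∑ i, LinearMap.mulLeft K (ExteriorAlgebra.ι K (e i)) ∘ₗ contractLeft (e.coord i)

theorem eulerOperator_apply {ι' : Type*} [Fintype ι'] (e : Module.Basis ι' K E)
    (x : ExteriorAlgebra K E) :
    eulerOperator e x = ∑ i, ExteriorAlgebra.ι K (e i) * contractLeft (e.coord i) x := by
  simp [eulerOperator]

theorem eulerOperator_ι_mul {ι' : Type*} [Fintype ι'] (e : Module.Basis ι' K E) (v : E)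
    (y : ExteriorAlgebra K E) :
    eulerOperator e (ExteriorAlgebra.ι K v * y)
      = ExteriorAlgebra.ι K v * y + ExteriorAlgebra.ι K v * eulerOperator e y := by
  have hanti : ∀ u w : E, ExteriorAlgebra.ι K u * ExteriorAlgebra.ι K w
      = -(ExteriorAlgebra.ι K w * ExteriorAlgebra.ι K u) := fun u w =>
    eq_neg_of_add_eq_zero_left (ExteriorAlgebra.ι_add_mul_swap u w)
  have h1 : ExteriorAlgebra.ι K v = ∑ i, e.coord i v • ExteriorAlgebra.ι K (e i) := by
    conv_lhs => rw [← e.sum_repr v]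
    simp only [map_sum, map_smul, Module.Basis.coord_apply]
  rw [eulerOperator_apply, eulerOperator_apply, Finset.mul_sum]
  nth_rewrite 2 [h1]
  rw [Finset.sum_mul, ← Finset.sum_add_distrib]
  refine Finset.sum_congr rfl fun i _ => ?_
  rw [show ExteriorAlgebra.ι K v = CliffordAlgebra.ι (0 : QuadraticForm K E) v from rfl,
    contractLeft_ι_mul, mul_sub, mul_smul_comm, smul_mul_assoc, sub_eq_add_neg]
  congr 1
  have := hanti (e i) v
  rw [← mul_assoc, ← mul_assoc]
  exact (congrArg (fun z => -(z * contractLeft (e.coord i) y)) this).trans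
    (by rw [neg_mul, neg_neg])

theorem eulerOperator_of_mem {ι' : Type*} [Fintype ι'] (e : Module.Basis ι' K E) (n : ℕ)
    {x : ExteriorAlgebra K E} (hx : x ∈ ⋀[K]^n E) : eulerOperator e x = n • x := by
  induction hx using Submodule.pow_induction_on_left' with
  | algebraMap r =>
    rw [eulerOperator_apply, zero_smul]
    refine Finset.sum_eq_zero fun i _ => ?_
    rw [contractLeft_algebraMap, mul_zero]
  | add x y i hx hy ihx ihy => rw [map_add, ihx, ihy, smul_add]
  | mem_mul m hm i x hx ih =>
    obtain ⟨v, rfl⟩ := hm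
    rw [eulerOperator_ι_mul, ih, mul_smul_comm, succ_nsmul']

/-- The Euler operator multiplies the component of degree `n` by `n`. -/
theorem decompose_eulerOperator {ι' : Type*} [Fintype ι'] (e : Module.Basis ι' K E) (n : ℕ)
    (x : ExteriorAlgebra K E) :
    (DirectSum.decompose (fun i : ℕ => ⋀[K]^i E) (eulerOperator e x) n : ExteriorAlgebra K E)
      = n • (DirectSum.decompose (fun i : ℕ => ⋀[K]^i E) x n : ExteriorAlgebra K E) := by
  induction x using DirectSum.Decomposition.inductionOn (fun i : ℕ => ⋀[K]^i E) with
  | zero => simp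
  | @homogeneous i m =>
    rw [eulerOperator_of_mem e i m.2]
    by_cases h : i = n
    · subst h
      rw [DirectSum.decompose_of_mem_same (fun i : ℕ => ⋀[K]^i E) (nsmul_mem m.2 i),
        DirectSum.decompose_of_mem_same (fun i : ℕ => ⋀[K]^i E) m.2]
    · rw [DirectSum.decompose_of_mem_ne (fun i : ℕ => ⋀[K]^i E) (nsmul_mem m.2 i) h,
        DirectSum.decompose_of_mem_ne (fun i : ℕ => ⋀[K]^i E) m.2 h, smul_zero]
  | add x y hx hy => 
    rw [map_add, DirectSum.decompose_add, DirectSum.decompose_add, DirectSum.add_apply,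
      DirectSum.add_apply, Submodule.coe_add, Submodule.coe_add, hx, hy, smul_add]

/-- An element `x` of the exterior algebra that solves a first-order system `d ⌋ x = w_d ∧ x` is
determined by its scalar part: the Euler operator turns the system into `n x_n = β ∧ x_{n-2}` for
the homogeneous components of `x`. -/
theorem exterior_eq_zero_of_contractLeft [CharZero K] [FiniteDimensional K E]
    {x : ExteriorAlgebra K E}
    (h : ∀ d : Module.Dual K E, ∃ w : E,
      contractLeft d x = ExteriorAlgebra.ι K w * x)
    (h0 : ExteriorAlgebra.algebraMapInv x = 0) : x = 0 := by
  classical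
  choose w hw using h
  let e := Module.finBasis K E
  set β : ExteriorAlgebra K E :=
    ∑ i, ExteriorAlgebra.ι K (e i) * ExteriorAlgebra.ι K (w (e.coord i)) with hβ
  have hβmem : β ∈ ⋀[K]^2 E := by
    refine Submodule.sum_mem _ fun i _ => ?_
    rw [show (⋀[K]^2 E) = LinearMap.range (ExteriorAlgebra.ι K) *
      LinearMap.range (ExteriorAlgebra.ι K) from pow_two _]
    exact Submodule.mul_mem_mul (LinearMap.mem_range_self _ _) (LinearMap.mem_range_self _ _)
  have hL : eulerOperator e x = β * x := by
    rw [eulerOperator_apply, hβ, Finset.sum_mul]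
    refine Finset.sum_congr rfl fun i _ => ?_
    rw [hw, mul_assoc]
  have hzero : ∀ n,
      (DirectSum.decompose (fun i : ℕ => ⋀[K]^i E) x n : ExteriorAlgebra K E) = 0 := by
    intro n
    induction n using Nat.strong_induction_on with
    | _ n ih =>
      rcases Nat.eq_zero_or_pos n with rfl | hn
      · have hsum := DirectSum.sum_support_decompose (fun i : ℕ => ⋀[K]^i E) x
        have h1 : ∀ i ≠ 0, ∀ y ∈ ⋀[K]^i E, ExteriorAlgebra.algebraMapInv y = 0 := by
          intro i hi y hy
          obtain ⟨i, rfl⟩ := Nat.exists_eq_succ_of_ne_zero hi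
          rw [show (⋀[K]^(i + 1) E) = LinearMap.range (ExteriorAlgebra.ι K) * (⋀[K]^i E) from
            pow_succ' _ _] at hy
          refine Submodule.mul_induction_on hy ?_ ?_
          · rintro _ ⟨v, rfl⟩ z hz
            rw [map_mul]
            simp [ExteriorAlgebra.algebraMapInv]
          · intro y z hy hz
            rw [map_add, hy, hz, add_zero]
        have h2 : ExteriorAlgebra.algebraMapInv x = ExteriorAlgebra.algebraMapInv
            (DirectSum.decompose (fun i : ℕ => ⋀[K]^i E) x 0 : ExteriorAlgebra K E) := by
          conv_lhs => rw [← hsum]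
          rw [map_sum]
          refine Finset.sum_eq_single 0 (fun i _ hi => h1 i hi _ (SetLike.coe_mem _)) ?_
          intro hi
          rw [DFinsupp.notMem_support_iff.1 hi]
          simp
        obtain ⟨c, hc⟩ : ∃ c : K, algebraMap K (ExteriorAlgebra K E) c =
            (DirectSum.decompose (fun i : ℕ => ⋀[K]^i E) x 0 : ExteriorAlgebra K E) := by
          have : ∀ y ∈ ⋀[K]^0 E, y ∈ (1 : Submodule K (ExteriorAlgebra K E)) := fun y hy => by
            rwa [show (⋀[K]^0 E) = 1 from pow_zero _] at hy
          exact Submodule.mem_one.1 (this _ (SetLike.coe_mem _))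
        rw [← hc, h0] at h2
        rw [← hc]
        have h3 : ExteriorAlgebra.algebraMapInv (algebraMap K (ExteriorAlgebra K E) c) = c :=
          ExteriorAlgebra.algebraMap_leftInverse E c
        rw [h3] at h2
        rw [← h2, map_zero]
      · have h1 := decompose_eulerOperator e n x
        rw [hL] at h1
        have h2 : (DirectSum.decompose (fun i : ℕ => ⋀[K]^i E) (β * x) n : ExteriorAlgebra K E)
            = 0 := by
          by_cases hn2 : 2 ≤ n
          · rw [DirectSum.coe_decompose_mul_of_left_mem_of_le (fun i : ℕ => ⋀[K]^i E) hβmem hn2,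
              ih (n - 2) (by omega),
              mul_zero]
          · exact DirectSum.coe_decompose_mul_of_left_mem_of_not_le (fun i : ℕ => ⋀[K]^i E) hβmem
              hn2
        rw [h2, ← Nat.cast_smul_eq_nsmul K] at h1
        exact (smul_eq_zero.1 h1.symm).resolve_left (Nat.cast_ne_zero.2 hn.ne')
  rw [← DirectSum.sum_support_decompose (fun i : ℕ => ⋀[K]^i E) x]
  exact Finset.sum_eq_zero fun i _ => hzero i

end ExteriorAlgebra

/-! ### The scalar part as a trace on the Clifford algebra -/

section ContractLeft

variable {K E : Type*} [Field K] [AddCommGroup E] [Module K E] {Q : QuadraticForm K E}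

theorem contractLeft_add_left (d d' : E →ₗ[K] K) (x : CliffordAlgebra Q) :
    contractLeft (d + d') x = contractLeft d x + contractLeft d' x := by
  rw [map_add CliffordAlgebra.contractLeft, LinearMap.add_apply]

theorem contractLeft_smul_left (c : K) (d : E →ₗ[K] K) (x : CliffordAlgebra Q) :
    contractLeft (c • d) x = c • contractLeft d x := by
  rw [map_smul CliffordAlgebra.contractLeft, LinearMap.smul_apply]

end ContractLeft

section Trace

variable {K E : Type*} [Field K] [CharZero K] [AddCommGroup E] [Module K E]
  {b : LinearMap.BilinForm K E}

/-- The linear isomorphism of the Clifford algebra with the exterior algebra. -/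
noncomputable def toExterior (b : LinearMap.BilinForm K E) :
    CliffordAlgebra (halfQuadraticForm b) ≃ₗ[K] ExteriorAlgebra K E :=
  letI : Invertible (2 : K) := invertibleOfNonzero two_ne_zero
  equivExterior (halfQuadraticForm b)

theorem toExterior_algebraMap (c : K) : toExterior b (algebraMap K _ c) = algebraMap K _ c := by
  simp only [toExterior, equivExterior, changeFormEquiv_apply, changeForm_algebraMap]

theorem toExterior_contractLeft (d : Module.Dual K E)
    (x : CliffordAlgebra (halfQuadraticForm b)) :
    toExterior b (contractLeft d x) = contractLeft d (toExterior b x) := by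
  simp only [toExterior, equivExterior, changeFormEquiv_apply, changeForm_contractLeft]

theorem toExterior_ι_mul (hb : b.IsSymm) (v : E) (x : CliffordAlgebra (halfQuadraticForm b)) :
    toExterior b (ι _ v * x) = ExteriorAlgebra.ι K v * toExterior b x
      + (2⁻¹ : K) • contractLeft (b v) (toExterior b x) := by
  let _ : Invertible (2 : K) := invertibleOfNonzero two_ne_zero
  have h : QuadraticMap.associated (R := K) (M := E) (-halfQuadraticForm b) v
      = (-2⁻¹ : K) • b v := by
    have h1 : -halfQuadraticForm b = LinearMap.BilinMap.toQuadraticMap (-((2⁻¹ : K) • b)) := by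
      ext w
      simp [halfQuadraticForm_apply]
    rw [h1, QuadraticMap.associated_left_inverse]
    · rw [LinearMap.neg_apply, LinearMap.smul_apply]
      exact (neg_smul _ _).symm
    · intro x y
      simp [hb.eq x y]
  simp only [toExterior, equivExterior, changeFormEquiv_apply, changeForm_ι_mul]
  rw [h, contractLeft_smul_left, neg_smul, sub_neg_eq_add]

/-- The scalar part of an element of the Clifford algebra, with respect to the identification
with the exterior algebra. It is a trace: see `scalarPart_mul_comm`. -/
noncomputable def scalarPart (b : LinearMap.BilinForm K E) :
    CliffordAlgebra (halfQuadraticForm b) →ₗ[K] K :=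
  ExteriorAlgebra.algebraMapInv.toLinearMap ∘ₗ (toExterior b).toLinearMap

theorem scalarPart_apply (x : CliffordAlgebra (halfQuadraticForm b)) :
    scalarPart b x = ExteriorAlgebra.algebraMapInv (toExterior b x) := rfl

theorem scalarPart_algebraMap (c : K) : scalarPart b (algebraMap K _ c) = c := by
  rw [scalarPart_apply, toExterior_algebraMap]
  exact ExteriorAlgebra.algebraMap_leftInverse E c

theorem scalarPart_ι_mul (hb : b.IsSymm) (v : E) (x : CliffordAlgebra (halfQuadraticForm b)) :
    scalarPart b (ι _ v * x) = 2⁻¹ * scalarPart b (contractLeft (b v) x) := by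
  simp only [scalarPart_apply, toExterior_ι_mul hb, toExterior_contractLeft, map_add, map_mul,
    map_smul, smul_eq_mul]
  simp [ExteriorAlgebra.algebraMapInv]

/-- The supercommutator with a vector `v` is the contraction with `b v`. -/
theorem ι_mul_sub_involute_mul_ι (hb : b.IsSymm) (v : E)
    (x : CliffordAlgebra (halfQuadraticForm b)) :
    ι _ v * x - involute x * ι _ v = contractLeft (b v) x := by
  induction x using CliffordAlgebra.left_induction with
  | algebraMap r => rw [contractLeft_algebraMap, AlgHom.commutes, Algebra.commutes, sub_self]
  | add x y hx hy => rw [map_add, map_add, ← hx, ← hy]; noncomm_ring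
  | ι_mul x m hx =>
    rw [contractLeft_ι_mul, ← hx, map_mul, involute_ι, Algebra.smul_def,
      ← ι_mul_ι_add_swap_eq b hb]
    noncomm_ring

theorem involute_contractLeft {Q : QuadraticForm K E} (d : Module.Dual K E)
    (x : CliffordAlgebra Q) : contractLeft d (involute x) = -involute (contractLeft d x) := by
  induction x using CliffordAlgebra.left_induction with
  | algebraMap r => simp
  | add x y hx hy => simp only [map_add, hx, hy, neg_add]
  | ι_mul x m hx =>
    rw [map_mul, involute_ι, neg_mul, map_neg, contractLeft_ι_mul, contractLeft_ι_mul, hx,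
      map_sub, map_mul, map_smul, involute_ι]
    noncomm_ring

theorem toExterior_involute (hb : b.IsSymm) (x : CliffordAlgebra (halfQuadraticForm b)) :
    toExterior b (involute x) = involute (toExterior b x) := by
  induction x using CliffordAlgebra.left_induction with
  | algebraMap r => rw [AlgHom.commutes, toExterior_algebraMap, AlgHom.commutes]
  | add x y hx hy => simp only [map_add, hx, hy]
  | ι_mul x m hx =>
    rw [map_mul, involute_ι, neg_mul, map_neg, toExterior_ι_mul hb, toExterior_ι_mul hb, hx,
      map_add, map_mul, map_smul, involute_contractLeft,
      show involute (ExteriorAlgebra.ι K m) = -ExteriorAlgebra.ι K m from involute_ι m,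
      neg_add, smul_neg, neg_neg, neg_mul]

theorem scalarPart_involute (hb : b.IsSymm) (x : CliffordAlgebra (halfQuadraticForm b)) :
    scalarPart b (involute x) = scalarPart b x := by
  have h : ExteriorAlgebra.algebraMapInv.comp involute
      = (ExteriorAlgebra.algebraMapInv : ExteriorAlgebra K E →ₐ[K] K) := by
    ext v
    simp [ExteriorAlgebra.algebraMapInv]
  rw [scalarPart_apply, scalarPart_apply, toExterior_involute hb]
  exact DFunLike.congr_fun h _

theorem scalarPart_mul_comm (hb : b.IsSymm) (x y : CliffordAlgebra (halfQuadraticForm b)) :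
    scalarPart b (x * y) = scalarPart b (y * x) := by
  have key : ∀ (v : E) (y : CliffordAlgebra (halfQuadraticForm b)),
      scalarPart b (ι _ v * y) = scalarPart b (y * ι _ v) := fun v y => by
    have h := ι_mul_sub_involute_mul_ι hb v (involute y)
    rw [involute_involute] at h
    rw [← sub_sub_cancel (ι (halfQuadraticForm b) v * involute y) (y * ι _ v), h, map_sub,
      scalarPart_ι_mul hb, scalarPart_ι_mul hb, involute_contractLeft, map_neg,
      scalarPart_involute hb]
    ring
  induction x using CliffordAlgebra.left_induction generalizing y with
  | algebraMap r => rw [Algebra.commutes]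
  | add x z hx hz => rw [add_mul, mul_add, map_add, map_add, hx, hz]
  | ι_mul x m hx => rw [mul_assoc, key, mul_assoc, hx, mul_assoc]

end Trace

/-! ### Lifts of isometries to the Clifford algebra -/

section Lifts

variable {K E : Type*} [Field K] [CharZero K] [AddCommGroup E] [Module K E]
  {b : LinearMap.BilinForm K E}

/-- The unit `x` of the Clifford algebra induces `g` on `E` by twisted conjugation, that is
`α(x) e x⁻¹ = g e`. No condition is put on the spinor norm of `x`. -/
def Lifts (b : LinearMap.BilinForm K E) (x : (CliffordAlgebra (halfQuadraticForm b))ˣ)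
    (g : E ≃ₗ[K] E) : Prop :=
  ∀ e, involute (x : CliffordAlgebra (halfQuadraticForm b)) * ι _ e
    = ι _ (g e) * (x : CliffordAlgebra (halfQuadraticForm b))

theorem Lifts.one : Lifts b 1 1 := fun e => by simp

theorem Lifts.mul {x y : (CliffordAlgebra (halfQuadraticForm b))ˣ} {g h : E ≃ₗ[K] E}
    (hx : Lifts b x g) (hy : Lifts b y h) : Lifts b (x * y) (g * h) := fun e => by
  rw [Units.val_mul, map_mul, mul_assoc, hy e, ← mul_assoc, hx, mul_assoc]
  rfl

theorem Lifts.inv {x : (CliffordAlgebra (halfQuadraticForm b))ˣ} {g : E ≃ₗ[K] E}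
    (hx : Lifts b x g) : Lifts b x⁻¹ g⁻¹ := fun e => by
  have h := hx (g⁻¹ e)
  rw [show g (g⁻¹ e) = e from g.apply_symm_apply e] at h
  have h1 : involute ((x⁻¹ : (CliffordAlgebra (halfQuadraticForm b))ˣ) :
      CliffordAlgebra (halfQuadraticForm b)) *
      involute (x : CliffordAlgebra (halfQuadraticForm b)) = 1 := by
    rw [← map_mul, Units.inv_mul, map_one]
  calc _ = involute ((x⁻¹ : (CliffordAlgebra (halfQuadraticForm b))ˣ) :
      CliffordAlgebra (halfQuadraticForm b)) *
      ((ι _ e * (x : CliffordAlgebra (halfQuadraticForm b))) *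
      ((x⁻¹ : (CliffordAlgebra (halfQuadraticForm b))ˣ) :
      CliffordAlgebra (halfQuadraticForm b))) := by rw [mul_assoc (ι _ e), Units.mul_inv, mul_one]
    _ = _ := by rw [← h, ← mul_assoc, ← mul_assoc, h1, one_mul]

/-- If `1 + u` is invertible, the lifts of `u` have a nonzero scalar part. With `u` the Cayley
transform of `a`, the image `X` of a lift in the exterior algebra satisfies
`b(f) ⌋ X = 2 (a f) ∧ X`. -/
theorem Lifts.scalarPart_ne_zero [FiniteDimensional K E] (hb : b.IsSymm) (hnd : b.Nondegenerate)
    {x : (CliffordAlgebra (halfQuadraticForm b))ˣ} {u : E ≃ₗ[K] E} (hx : Lifts b x u)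
    (hu : ∀ e, u e = -e → e = 0) :
    scalarPart b (x : CliffordAlgebra (halfQuadraticForm b)) ≠ 0 := by
  intro h0
  have hinj : Function.Injective ((2⁻¹ : K) • (LinearMap.id + u.toLinearMap) : E →ₗ[K] E) := by
    rw [injective_iff_map_eq_zero]
    intro e he
    have h2 : e + u e = 0 := (smul_eq_zero.1 he).resolve_left (inv_ne_zero two_ne_zero)
    exact hu e (eq_neg_of_add_eq_zero_right h2)
  have hsurj := LinearMap.injective_iff_surjective.1 hinj
  set X := toExterior b (x : CliffordAlgebra (halfQuadraticForm b)) with hX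
  have hX0 : X = 0 := by
    refine exterior_eq_zero_of_contractLeft (fun d => ?_) h0
    obtain ⟨f, rfl⟩ := (LinearMap.BilinForm.toDual b hnd).surjective d
    obtain ⟨e, rfl⟩ := hsurj f
    have h1 := ι_mul_sub_involute_mul_ι hb e (x : CliffordAlgebra (halfQuadraticForm b))
    rw [hx e, ← sub_mul, ← map_sub] at h1
    have h2 := congrArg (toExterior b) h1
    rw [toExterior_ι_mul hb, toExterior_contractLeft, ← hX, map_sub, map_sub,
      sub_eq_add_neg (b e), ← neg_one_smul K (b (u e)), contractLeft_add_left,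
      contractLeft_smul_left, neg_one_smul, ← sub_eq_add_neg] at h2
    refine ⟨e - u e, ?_⟩
    have h3 : LinearMap.BilinForm.toDual b hnd
        (((2⁻¹ : K) • (LinearMap.id + u.toLinearMap) : E →ₗ[K] E) e)
        = (2⁻¹ : K) • (b e + b (u e)) := by
      ext w
      simp [LinearMap.BilinForm.toDual_def]
    rw [h3, contractLeft_smul_left, contractLeft_add_left, map_sub]
    rw [smul_sub, ← eq_sub_iff_add_eq] at h2
    rw [h2, smul_add]
    have h4 : contractLeft (b e) X = (2⁻¹ : K) • contractLeft (b e) X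
        + (2⁻¹ : K) • contractLeft (b e) X := by
      rw [← add_smul, ← two_mul, mul_inv_cancel₀ two_ne_zero, one_smul]
    nth_rewrite 2 [h4]
    abel
  have hx0 : (x : CliffordAlgebra (halfQuadraticForm b)) = 0 :=
    (toExterior b).map_eq_zero_iff.1 hX0
  have h1 := x.mul_inv
  rw [hx0, zero_mul] at h1
  have h2 := congrArg (scalarPart b) h1
  rw [map_zero, ← map_one (algebraMap K _), scalarPart_algebraMap] at h2
  exact zero_ne_one h2

theorem Lifts.eq_algebraMap [FiniteDimensional K E] (hb : b.IsSymm) (hnd : b.Nondegenerate)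
    {x : (CliffordAlgebra (halfQuadraticForm b))ˣ} (hx : Lifts b x 1) :
    ∃ c : K, (x : CliffordAlgebra (halfQuadraticForm b)) = algebraMap K _ c := by
  refine ⟨scalarPart b (x : CliffordAlgebra (halfQuadraticForm b)), ?_⟩
  rw [← sub_eq_zero]
  refine (toExterior b).map_eq_zero_iff.1 (exterior_eq_zero_of_contractLeft (fun d => ⟨0, ?_⟩) ?_)
  · obtain ⟨e, rfl⟩ := (LinearMap.BilinForm.toDual b hnd).surjective d
    have h1 := ι_mul_sub_involute_mul_ι hb e (x : CliffordAlgebra (halfQuadraticForm b))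
    rw [hx e, LinearEquiv.coe_one, id, sub_self] at h1
    rw [← toExterior_contractLeft, map_sub, contractLeft_algebraMap, sub_zero]
    change toExterior b (contractLeft (b e) _) = _
    rw [← h1]
    simp
  · rw [← scalarPart_apply, map_sub, scalarPart_algebraMap, sub_self]

/-- Two lifts of the same isometry differ by a scalar. -/
theorem Lifts.exists_smul [FiniteDimensional K E] (hb : b.IsSymm) (hnd : b.Nondegenerate)
    {x y : (CliffordAlgebra (halfQuadraticForm b))ˣ} {g : E ≃ₗ[K] E} (hx : Lifts b x g)
    (hy : Lifts b y g) :
    ∃ c : K, (x : CliffordAlgebra (halfQuadraticForm b)) = algebraMap K _ c * y := by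
  have h := hx.mul hy.inv
  rw [mul_inv_cancel] at h
  obtain ⟨c, hc⟩ := h.eq_algebraMap hb hnd
  exact ⟨c, by rw [← hc, ← Units.val_mul, inv_mul_cancel_right]⟩

/-- If `u` commutes with `g` and `1 + u` is invertible, then the lifts of `u` and `g` commute: they
commute up to a scalar, which preserves the nonzero scalar part of the lift of `u`. -/
theorem Lifts.commute_of_cayley [FiniteDimensional K E] (hb : b.IsSymm) (hnd : b.Nondegenerate)
    {x y : (CliffordAlgebra (halfQuadraticForm b))ˣ} {g u : E ≃ₗ[K] E} (hx : Lifts b x g)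
    (hy : Lifts b y u) (hgu : Commute g u) (hu : ∀ e, u e = -e → e = 0) : Commute x y := by
  have h := (hx.mul hy).mul hx.inv
  rw [hgu.eq, mul_inv_cancel_right] at h
  obtain ⟨c, hc⟩ := h.exists_smul hb hnd hy
  have h1 := congrArg (scalarPart b) hc
  rw [Units.val_mul, scalarPart_mul_comm hb, ← Units.val_mul, inv_mul_cancel_left,
    ← Algebra.smul_def, map_smul, smul_eq_mul] at h1
  have hc1 : c = 1 :=
    mul_right_cancel₀ (hy.scalarPart_ne_zero hb hnd hu) (by rw [one_mul]; exact h1.symm)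
  rw [hc1, map_one, one_mul] at hc
  exact mul_inv_eq_iff_eq_mul.1 (Units.ext hc)

end Lifts

/-! ### Determinants on invariant subspaces -/

section Determinants

variable {K E : Type*} [Field K] [AddCommGroup E] [Module K E] [FiniteDimensional K E]

theorem det_eq_mul_of_isCompl (f : E →ₗ[K] E) {p q : Submodule K E} (hpq : IsCompl p q)
    (hp : ∀ x ∈ p, f x ∈ p) (hq : ∀ x ∈ q, f x ∈ q) :
    LinearMap.det f = LinearMap.det (f.restrict hp) * LinearMap.det (f.restrict hq) := by
  rw [← LinearMap.det_prodMap, ← LinearMap.det_conj _ (Submodule.prodEquivOfIsCompl p q hpq)]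
  congr 1
  ext x
  obtain ⟨⟨y, z⟩, rfl⟩ := (Submodule.prodEquivOfIsCompl p q hpq).surjective x
  simp

theorem det_restrict_eq_mul (f : E →ₗ[K] E) {p q r : Submodule K E} (hpq : Disjoint p q)
    (hr : p ⊔ q = r) (hfp : ∀ x ∈ p, f x ∈ p) (hfq : ∀ x ∈ q, f x ∈ q) (hfr : ∀ x ∈ r, f x ∈ r) :
    LinearMap.det (f.restrict hfr)
      = LinearMap.det (f.restrict hfp) * LinearMap.det (f.restrict hfq) := by
  subst hr
  let s : (p × q) →ₗ[K] (p ⊔ q : Submodule K E) :=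
    (Submodule.inclusion le_sup_left).coprod (Submodule.inclusion le_sup_right)
  have hs : Function.Bijective s := by
    constructor
    · rw [injective_iff_map_eq_zero]
      rintro ⟨x, y⟩ h
      have h1 : (x : E) + y = 0 := congrArg Subtype.val h
      have hx : (x : E) = 0 := Submodule.disjoint_def.1 hpq _ x.2
        (eq_neg_of_add_eq_zero_left h1 ▸ q.neg_mem y.2)
      rw [hx, zero_add] at h1
      exact Prod.ext (Subtype.ext hx) (Subtype.ext h1)
    · rintro ⟨z, hz⟩
      obtain ⟨x, hx, y, hy, rfl⟩ := Submodule.mem_sup.1 hz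
      exact ⟨(⟨x, hx⟩, ⟨y, hy⟩), rfl⟩
  rw [← LinearMap.det_prodMap, ← LinearMap.det_conj _ (LinearEquiv.ofBijective s hs)]
  congr 1
  ext z
  obtain ⟨⟨x, y⟩, rfl⟩ := (LinearEquiv.ofBijective s hs).surjective z
  simp only [LinearMap.comp_apply, LinearEquiv.coe_coe, LinearEquiv.symm_apply_apply]
  change f (x + y) = f x + f y
  rw [map_add]

/-- Two endomorphisms that preserve a perfect pairing are contragredient to each other. -/
theorem det_mul_det_of_pairing {V W : Type*} [AddCommGroup V] [Module K V] [FiniteDimensional K V]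
    [AddCommGroup W] [Module K W] [FiniteDimensional K W] (B : V →ₗ[K] W →ₗ[K] K)
    (hl : ∀ v, (∀ w, B v w = 0) → v = 0) (hr : ∀ w, (∀ v, B v w = 0) → w = 0)
    (f : V →ₗ[K] V) (h : W →ₗ[K] W) (hfh : ∀ v w, B (f v) (h w) = B v w) :
    LinearMap.det f * LinearMap.det h = 1 := by
  have hB : Function.Injective B := by
    rw [injective_iff_map_eq_zero]
    exact fun v hv => hl v fun w => by rw [hv, LinearMap.zero_apply]
  have hB' : Function.Injective B.flip := by
    rw [injective_iff_map_eq_zero]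
    exact fun w hw => hr w fun v => by rw [← LinearMap.flip_apply, hw, LinearMap.zero_apply]
  have hdim : Module.finrank K V = Module.finrank K (W →ₗ[K] K) := by
    have h1 := LinearMap.finrank_le_finrank_of_injective hB
    have h2 := LinearMap.finrank_le_finrank_of_injective hB'
    have h3 : Module.finrank K (V →ₗ[K] K) = Module.finrank K V := Subspace.dual_finrank_eq
    have h4 : Module.finrank K (W →ₗ[K] K) = Module.finrank K W := Subspace.dual_finrank_eq
    omega
  let e : V ≃ₗ[K] (W →ₗ[K] K) := LinearMap.linearEquivOfInjective B hB hdim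
  have he : ∀ v, e v = B v := fun v => rfl
  have h1 : h.dualMap ∘ₗ (e.toLinearMap ∘ₗ f ∘ₗ e.symm.toLinearMap) = LinearMap.id := by
    refine LinearMap.ext fun d => ?_
    obtain ⟨v, rfl⟩ := e.surjective d
    refine LinearMap.ext fun w => ?_
    simp only [LinearMap.comp_apply, LinearEquiv.coe_coe, LinearEquiv.symm_apply_apply]
    simp only [he, LinearMap.dualMap_apply, LinearMap.id_apply, hfh]
  have h2 := congrArg LinearMap.det h1
  rwa [LinearMap.det_comp, LinearMap.det_dualMap, LinearMap.det_conj, LinearMap.det_id,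
    mul_comm] at h2

theorem det_restrict_eq_one_of_forall_eq (f : E →ₗ[K] E) {p : Submodule K E}
    (hp : ∀ x ∈ p, f x ∈ p) (h : ∀ x ∈ p, f x = x) : LinearMap.det (f.restrict hp) = 1 := by
  have : f.restrict hp = LinearMap.id := LinearMap.ext fun x => Subtype.ext (h x x.2)
  rw [this, LinearMap.det_id]

theorem det_restrict_congr {f f' : E →ₗ[K] E} {p : Submodule K E}
    (hp : ∀ x ∈ p, f x ∈ p) (hp' : ∀ x ∈ p, f' x ∈ p) (h : ∀ x ∈ p, f x = f' x) :
    LinearMap.det (f.restrict hp) = LinearMap.det (f'.restrict hp') := by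
  have : f.restrict hp = f'.restrict hp' := LinearMap.ext fun x => Subtype.ext (h x x.2)
  rw [this]

theorem det_of_forall_eq_neg (f : E →ₗ[K] E) (h : ∀ x, f x = -x) :
    LinearMap.det f = (-1) ^ Module.finrank K E := by
  have : f = (-1 : K) • LinearMap.id := LinearMap.ext fun x => by simp [h]
  rw [this, LinearMap.det_smul, LinearMap.det_id, mul_one]

end Determinants

/-! ### Reflections and products of vectors -/

section Reflections

variable {K E : Type*} [Field K] [CharZero K] [AddCommGroup E] [Module K E]
  {b : LinearMap.BilinForm K E}

/-- The orthogonal reflection in an anisotropic vector `w`. -/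
noncomputable def vectorReflection (b : LinearMap.BilinForm K E) (w : E) (hw : b w w ≠ 0) :
    E ≃ₗ[K] E :=
  Module.reflection (x := w) (f := (2 * (b w w)⁻¹) • b w) (by
    rw [LinearMap.smul_apply, smul_eq_mul, inv_mul_cancel_right₀ hw])

theorem vectorReflection_apply {w : E} (hw : b w w ≠ 0) (e : E) :
    vectorReflection b w hw e = e - (2 * (b w w)⁻¹ * b w e) • w := by
  rw [vectorReflection, Module.reflection_apply, LinearMap.smul_apply, smul_eq_mul]

theorem vectorReflection_self {w : E} (hw : b w w ≠ 0) : vectorReflection b w hw w = -w := by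
  rw [vectorReflection_apply, inv_mul_cancel_right₀ hw, two_smul]
  abel

theorem vectorReflection_of_orthogonal {w : E} (hw : b w w ≠ 0) {e : E} (he : b w e = 0) :
    vectorReflection b w hw e = e := by
  rw [vectorReflection_apply, he, mul_zero, zero_smul, sub_zero]

theorem vectorReflection_mul_self {w : E} (hw : b w w ≠ 0) :
    vectorReflection b w hw * vectorReflection b w hw = 1 :=
  LinearEquiv.ext fun e => Module.involutive_reflection _ e

theorem vectorReflection_mem (hb : b.IsSymm) {w : E} (hw : b w w ≠ 0) :
    vectorReflection b w hw ∈ orthogonalGroup b := fun u v => by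
  simp only [vectorReflection_apply, map_sub, map_smul, LinearMap.sub_apply,
    LinearMap.smul_apply, smul_eq_mul, hb.eq u w]
  field_simp
  ring

theorem vectorReflection_sub_apply (hb : b.IsSymm) {a c : E} (hac : b a a = b c c)
    (h : b (a - c) (a - c) ≠ 0) : vectorReflection b (a - c) h a = c := by
  have h1 : b (a - c) (a - c) = 2 * b (a - c) a := by
    simp only [map_sub, LinearMap.sub_apply, hac, hb.eq a c]
    ring
  have h2 : 2 * (b (a - c) (a - c))⁻¹ * b (a - c) a = 1 := by
    rw [mul_right_comm, ← h1, mul_inv_cancel₀ h]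
  rw [vectorReflection_apply, h2, one_smul, sub_sub_cancel]

theorem det_vectorReflection [FiniteDimensional K E] {w : E} (hw : b w w ≠ 0) :
    LinearMap.det (vectorReflection b w hw).toLinearMap = -1 := by
  have hc := LinearMap.BilinForm.isCompl_span_singleton_orthogonal (B := b) (x := w) hw
  have hp : ∀ x ∈ K ∙ w, vectorReflection b w hw x = -x := fun x hx => by
    obtain ⟨c, rfl⟩ := Submodule.mem_span_singleton.1 hx
    rw [map_smul, vectorReflection_self, smul_neg]
  have hq : ∀ x ∈ b.orthogonal (K ∙ w), vectorReflection b w hw x = x := fun x hx =>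
    vectorReflection_of_orthogonal hw (hx w (Submodule.mem_span_singleton_self w))
  rw [det_eq_mul_of_isCompl (vectorReflection b w hw).toLinearMap hc
    (fun x hx => by rw [LinearEquiv.coe_coe, hp x hx]; exact neg_mem hx)
    (fun x hx => by rw [LinearEquiv.coe_coe, hq x hx]; exact hx),
    det_restrict_eq_one_of_forall_eq _ _ hq, mul_one, det_of_forall_eq_neg]
  · rw [finrank_span_singleton, pow_one]
    rintro rfl
    simp at hw
  · exact fun x => Subtype.ext (hp x x.2)

/-- The unit `x` of the Clifford algebra has the properties of a product of `k` anisotropic vectors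
of `F`: it lifts an isometry `g` of determinant `(-1) ^ k`, has parity `k`, has a scalar spinor
norm, and commutes up to `s ^ k` with whatever commutes up to `s` with the vectors of `F`. -/
structure IsVectorProductLift (b : LinearMap.BilinForm K E) (F : Submodule K E) (g : E ≃ₗ[K] E)
    (k : ℕ) (x : (CliffordAlgebra (halfQuadraticForm b))ˣ) : Prop where
  lifts : Lifts b x g
  det : LinearMap.det g.toLinearMap = (-1) ^ k
  involute_eq : involute (x : CliffordAlgebra (halfQuadraticForm b)) = (-1 : K) ^ k • ↑x
  norm : ∃ c : Kˣ, (x : CliffordAlgebra (halfQuadraticForm b)) *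
    reverse (involute (x : CliffordAlgebra (halfQuadraticForm b))) = algebraMap K _ (c : K)
  mul_eq_smul : ∀ (y : CliffordAlgebra (halfQuadraticForm b)) (s : K),
    (∀ v ∈ F, y * ι _ v = s • (ι _ v * y)) → y * x = s ^ k • (x * y)

theorem IsVectorProductLift.one (F : Submodule K E) : IsVectorProductLift b F 1 0 1 where
  lifts := Lifts.one
  det := by rw [pow_zero]; exact LinearMap.det_id
  involute_eq := by simp
  norm := ⟨1, by simp⟩
  mul_eq_smul := by simp

theorem IsVectorProductLift.mul {F : Submodule K E} {g h : E ≃ₗ[K] E} {k l : ℕ}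
    {x y : (CliffordAlgebra (halfQuadraticForm b))ˣ} (hx : IsVectorProductLift b F g k x)
    (hy : IsVectorProductLift b F h l y) : IsVectorProductLift b F (g * h) (k + l) (x * y) where
  lifts := hx.lifts.mul hy.lifts
  det := by rw [pow_add, ← hx.det, ← hy.det]; exact LinearMap.det_comp _ _
  involute_eq := by
    rw [Units.val_mul, map_mul, hx.involute_eq, hy.involute_eq, smul_mul_smul_comm, pow_add]
  norm := by
    obtain ⟨c, hc⟩ := hx.norm
    obtain ⟨d, hd⟩ := hy.norm
    refine ⟨c * d, ?_⟩
    rw [Units.val_mul, map_mul, reverse.map_mul, mul_assoc,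
      ← mul_assoc (y : CliffordAlgebra (halfQuadraticForm b)), hd,
      Algebra.commutes, ← mul_assoc, hc, Units.val_mul, map_mul]
  mul_eq_smul z s hz := by
    rw [Units.val_mul, ← mul_assoc, hx.mul_eq_smul z s hz, smul_mul_assoc, mul_assoc,
      hy.mul_eq_smul z s hz, mul_smul_comm, smul_smul, ← pow_add, mul_assoc]

theorem IsVectorProductLift.mono {F F' : Submodule K E} (hF : F ≤ F') {g : E ≃ₗ[K] E} {k : ℕ}
    {x : (CliffordAlgebra (halfQuadraticForm b))ˣ} (hx : IsVectorProductLift b F g k x) :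
    IsVectorProductLift b F' g k x :=
  { hx with mul_eq_smul := fun z s hz => hx.mul_eq_smul z s fun v hv => hz v (hF hv) }

theorem exists_isVectorProductLift_vectorReflection [FiniteDimensional K E] (hb : b.IsSymm)
    {F : Submodule K E} {w : E} (hwF : w ∈ F) (hw : b w w ≠ 0) :
    ∃ x, IsVectorProductLift b F (vectorReflection b w hw) 1 x := by
  have hq : halfQuadraticForm b w ≠ 0 := by
    rw [halfQuadraticForm_apply]
    exact mul_ne_zero (inv_ne_zero two_ne_zero) hw
  have hsq : ∀ c : K, ι (halfQuadraticForm b) w * (c • ι _ w)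
      = algebraMap K _ (c * halfQuadraticForm b w) := fun c => by
    rw [mul_smul_comm, ι_sq_scalar, Algebra.smul_def, map_mul]
  let x : (CliffordAlgebra (halfQuadraticForm b))ˣ :=
    { val := ι _ w
      inv := (halfQuadraticForm b w)⁻¹ • ι _ w
      val_inv := by rw [hsq, inv_mul_cancel₀ hq, map_one]
      inv_val := by rw [smul_mul_assoc, ← mul_smul_comm, hsq, inv_mul_cancel₀ hq, map_one] }
  refine ⟨x, fun e => ?_, ?_, ?_, ⟨Units.mk0 _ (neg_ne_zero.2 hq), ?_⟩, fun y s hy => ?_⟩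
  · change involute (ι _ w) * ι _ e = ι _ _ * ι _ w
    have h := ι_mul_ι_add_swap_eq b hb w e
    rw [involute_ι, vectorReflection_apply, map_sub, map_smul, sub_mul, smul_mul_assoc,
      ι_sq_scalar, halfQuadraticForm_apply, Algebra.smul_def,
      ← map_mul (algebraMap K _),
      show 2 * (b w w)⁻¹ * b w e * (2⁻¹ * b w w) = b w e by field_simp, ← h]
    noncomm_ring
  · rw [det_vectorReflection hw, pow_one]
  · change involute (ι _ w) = _ • ι _ w
    rw [involute_ι, pow_one, neg_one_smul]
  · change ι _ w * reverse (involute (ι _ w)) = _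
    rw [involute_ι, map_neg, reverse_ι, mul_neg, ι_sq_scalar, Units.val_mk0, map_neg]
  · rw [pow_one]
    exact hy w hwF

theorem exists_isVectorProductLift_of_reflection_mul [FiniteDimensional K E] (hb : b.IsSymm)
    {F : Submodule K E} {w : E} (hwF : w ∈ F) (hw : b w w ≠ 0) {g : E ≃ₗ[K] E}
    (h : ∃ k x, IsVectorProductLift b F (vectorReflection b w hw * g) k x) :
    ∃ k x, IsVectorProductLift b F g k x := by
  obtain ⟨k, x, hx⟩ := h
  obtain ⟨y, hy⟩ := exists_isVectorProductLift_vectorReflection hb hwF hw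
  refine ⟨1 + k, y * x, ?_⟩
  have := hy.mul hx
  rwa [← mul_assoc, vectorReflection_mul_self, one_mul] at this

theorem disjoint_top_orthogonal (hb : b.IsSymm) (hnd : b.Nondegenerate) :
    Disjoint ⊤ (b.orthogonal ⊤) := by
  rw [Submodule.disjoint_def]
  exact fun x _ hx => hnd.1 x fun y => by rw [hb.eq]; exact hx y Submodule.mem_top

theorem exists_anisotropic_of_disjoint (hb : b.IsSymm) {F : Submodule K E}
    (hF : Disjoint F (b.orthogonal F)) (hF0 : F ≠ ⊥) : ∃ v ∈ F, b v v ≠ 0 := by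
  by_contra! h
  have hle : F ≤ b.orthogonal F := by
    intro x hx y hy
    have h1 := h _ (F.add_mem hx hy)
    rw [map_add, map_add, LinearMap.add_apply, LinearMap.add_apply, h x hx, h y hy, hb.eq x y,
      zero_add, add_zero, ← two_mul] at h1
    exact (mul_eq_zero.1 h1).resolve_left two_ne_zero
  exact hF0 (disjoint_self.1 (hF.mono_right hle))

/-- A form of the Cartan–Dieudonné theorem: an isometry that fixes the orthogonal complement of a
nondegenerate subspace `F` is a product of reflections in vectors of `F`. -/
theorem exists_isVectorProductLift [FiniteDimensional K E] (hb : b.IsSymm) (hnd : b.Nondegenerate)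
    (F : Submodule K E) (hF : Disjoint F (b.orthogonal F)) (g : E ≃ₗ[K] E)
    (hg : g ∈ orthogonalGroup b) (hgF : ∀ e ∈ b.orthogonal F, g e = e) :
    ∃ k x, IsVectorProductLift b F g k x := by
  induction hn : Module.finrank K F using Nat.strong_induction_on generalizing F g with
  | _ n ih =>
    by_cases hF0 : F = ⊥
    · have : g = 1 := LinearEquiv.ext fun e => hgF e (by
        intro v hv
        rw [hF0, Submodule.mem_bot] at hv
        simp [hv])
      rw [this]
      exact ⟨_, _, IsVectorProductLift.one F⟩
    obtain ⟨v, hvF, hv⟩ := exists_anisotropic_of_disjoint hb hF hF0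
    have hgv : g v ∈ F := by
      rw [← LinearMap.BilinForm.orthogonal_orthogonal hnd hb.isRefl F]
      intro e he
      rw [← hgF e he, hg, hb.eq]
      exact he v hvF
    have hlt : Module.finrank K (F ⊓ b.orthogonal (K ∙ v) : Submodule K E) < n := by
      rw [← hn]
      refine Submodule.finrank_lt_finrank_of_lt (lt_of_le_of_ne inf_le_left fun h => hv ?_)
      rw [← h] at hvF
      exact hvF.2 v (Submodule.mem_span_singleton_self v)
    have hvmem : ∀ e : E, b v e = 0 → e ∈ b.orthogonal (K ∙ v) := fun e he w hw => by
      obtain ⟨c, rfl⟩ := Submodule.mem_span_singleton.1 hw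
      rw [map_smul, LinearMap.smul_apply, he, smul_zero]
    -- An element of `F'ᗮ` that is orthogonal to `v` is orthogonal to `F = F' ⊕ K v`.
    have hperp : ∀ e ∈ b.orthogonal (F ⊓ b.orthogonal (K ∙ v)), b v e = 0 → e ∈ b.orthogonal F := by
      intro e he hve f hf
      have h1 : f - ((b v v)⁻¹ * b v f) • v ∈ F ⊓ b.orthogonal (K ∙ v) := by
        refine ⟨F.sub_mem hf (F.smul_mem _ hvF), hvmem _ ?_⟩
        rw [map_sub, map_smul, smul_eq_mul]
        field_simp
        ring
      have h2 := he _ h1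
      rwa [map_sub, map_smul, LinearMap.sub_apply,
        LinearMap.smul_apply, hve, smul_zero, sub_zero] at h2
    have hdisj : Disjoint (F ⊓ b.orthogonal (K ∙ v)) (b.orthogonal (F ⊓ b.orthogonal (K ∙ v))) := by
      rw [Submodule.disjoint_def]
      intro x hx hx'
      exact Submodule.disjoint_def.1 hF x hx.1
        (hperp x hx' (hx.2 v (Submodule.mem_span_singleton_self v)))
    have key : ∀ h : E ≃ₗ[K] E, h ∈ orthogonalGroup b → (∀ e ∈ b.orthogonal F, h e = e) →
        h v = v → ∃ k x, IsVectorProductLift b F h k x := by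
      intro h hh hhF hhv
      obtain ⟨k, x, hx⟩ := ih _ hlt (F ⊓ b.orthogonal (K ∙ v)) hdisj h hh (fun e he => by
        have h1 : e - ((b v v)⁻¹ * b v e) • v ∈ b.orthogonal F := by
          refine hperp _ (fun f hf => ?_) ?_
          · rw [map_sub, map_smul, he f hf, hb.eq f v,
              hf.2 v (Submodule.mem_span_singleton_self v), smul_zero, sub_zero]
          · rw [map_sub, map_smul, smul_eq_mul]
            field_simp
            ring
        have h2 := hhF _ h1
        rw [map_sub, map_smul, hhv] at h2
        exact sub_left_injective h2) rfl
      exact ⟨k, x, hx.mono inf_le_left⟩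
    have hfix : ∀ w (_ : w ∈ F) (hw : b w w ≠ 0), ∀ e ∈ b.orthogonal F,
        vectorReflection b w hw e = e := fun w hwF hw e he =>
      vectorReflection_of_orthogonal hw (he w hwF)
    by_cases h1 : b (g v - v) (g v - v) = 0
    · have h2 : b (g v - -v) (g v - -v) ≠ 0 := by
        intro h2
        have h3 : b (g v - v) (g v - v) + b (g v - -v) (g v - -v) = 4 * b v v := by
          have := hg v v
          simp only [map_sub, map_neg, LinearMap.sub_apply, LinearMap.neg_apply, this]
          ring
        rw [h1, h2, add_zero] at h3
        exact hv ((mul_eq_zero.1 h3.symm).resolve_left (by norm_num))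
      have h2F : g v - -v ∈ F := F.sub_mem hgv (F.neg_mem hvF)
      refine exists_isVectorProductLift_of_reflection_mul hb h2F h2
        (exists_isVectorProductLift_of_reflection_mul hb hvF hv (key _ ?_ ?_ ?_))
      · exact mul_mem (vectorReflection_mem hb hv) (mul_mem (vectorReflection_mem hb h2) hg)
      · intro e he
        change vectorReflection b v hv (vectorReflection b _ h2 (g e)) = e
        rw [hgF e he, hfix _ h2F h2 e he, hfix v hvF hv e he]
      · change vectorReflection b v hv (vectorReflection b _ h2 (g v)) = v
        rw [vectorReflection_sub_apply hb (by rw [hg]; simp), map_neg, vectorReflection_self,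
          neg_neg]
    · have h1F : g v - v ∈ F := F.sub_mem hgv hvF
      refine exists_isVectorProductLift_of_reflection_mul hb h1F h1 (key _ ?_ ?_ ?_)
      · exact mul_mem (vectorReflection_mem hb h1) hg
      · intro e he
        change vectorReflection b _ h1 (g e) = e
        rw [hgF e he, hfix _ h1F h1 e he]
      · exact vectorReflection_sub_apply hb (hg v v) h1

theorem exists_isVectorProductLift_top [FiniteDimensional K E] (hb : b.IsSymm)
    (hnd : b.Nondegenerate) (g : E ≃ₗ[K] E) (hg : g ∈ orthogonalGroup b) :
    ∃ k x, IsVectorProductLift b ⊤ g k x :=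
  exists_isVectorProductLift hb hnd ⊤ (disjoint_top_orthogonal hb hnd) g hg fun e he => by
    rw [Submodule.disjoint_def.1 (disjoint_top_orthogonal hb hnd) e Submodule.mem_top he, map_zero]

end Reflections

/-! ### A determinant criterion for lifts to commute -/

section CommutingLifts

variable {K E : Type*} [Field K] [CharZero K] [AddCommGroup E] [Module K E]
  [FiniteDimensional K E] {b : LinearMap.BilinForm K E}

theorem linearEquiv_ext_of_isCompl {p q : Submodule K E} (hpq : IsCompl p q) {g h : E ≃ₗ[K] E}
    (hp : ∀ x ∈ p, g x = h x) (hq : ∀ x ∈ q, g x = h x) : g = h := by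
  refine LinearEquiv.ext fun e => ?_
  obtain ⟨x, hx, y, hy, rfl⟩ := Submodule.mem_sup.1 (hpq.sup_eq_top ▸ Submodule.mem_top : e ∈ p ⊔ q)
  rw [map_add, map_add, hp x hx, hq y hy]

/-- Isometries of the two summands of an orthogonal decomposition glue to an isometry. -/
theorem exists_glue (hb : b.IsSymm) {p q : Submodule K E} (hpq : IsCompl p q)
    (horth : ∀ x ∈ p, ∀ y ∈ q, b x y = 0) {g h : E ≃ₗ[K] E} (hg : g ∈ orthogonalGroup b)
    (hh : h ∈ orthogonalGroup b) (hgp : ∀ x ∈ p, g x ∈ p) (hhq : ∀ x ∈ q, h x ∈ q) :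
    ∃ k ∈ orthogonalGroup b, (∀ x ∈ p, k x = g x) ∧ (∀ x ∈ q, k x = h x) := by
  let f : E →ₗ[K] E := g.toLinearMap ∘ₗ p.subtype ∘ₗ p.projectionOnto q hpq
    + h.toLinearMap ∘ₗ q.subtype ∘ₗ q.projectionOnto p hpq.symm
  have hfp : ∀ x ∈ p, f x = g x := fun x hx => by
    have h1 := Submodule.projectionOnto_apply_left hpq ⟨x, hx⟩
    have h2 := Submodule.projectionOnto_apply_right hpq.symm ⟨x, hx⟩
    simp only [f, LinearMap.add_apply, LinearMap.comp_apply] at *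
    rw [h1, h2]
    simp
  have hfq : ∀ x ∈ q, f x = h x := fun x hx => by
    have h1 := Submodule.projectionOnto_apply_right hpq ⟨x, hx⟩
    have h2 := Submodule.projectionOnto_apply_left hpq.symm ⟨x, hx⟩
    simp only [f, LinearMap.add_apply, LinearMap.comp_apply] at *
    rw [h1, h2]
    simp
  have hsup : ∀ e, ∃ x ∈ p, ∃ y ∈ q, x + y = e := fun e =>
    Submodule.mem_sup.1 (hpq.sup_eq_top ▸ Submodule.mem_top : e ∈ p ⊔ q)
  have hinj : Function.Injective f := by
    rw [injective_iff_map_eq_zero]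
    intro e he
    obtain ⟨x, hx, y, hy, rfl⟩ := hsup e
    rw [map_add, hfp x hx, hfq y hy] at he
    have h1 : g x = 0 := Submodule.disjoint_def.1 hpq.disjoint _ (hgp x hx)
      (eq_neg_of_add_eq_zero_left he ▸ q.neg_mem (hhq y hy))
    rw [h1, zero_add] at he
    rw [g.map_eq_zero_iff.1 h1, h.map_eq_zero_iff.1 he, add_zero]
  refine ⟨LinearEquiv.ofInjectiveEndo f hinj, fun e e' => ?_, hfp, hfq⟩
  obtain ⟨x, hx, y, hy, rfl⟩ := hsup e
  obtain ⟨x', hx', y', hy', rfl⟩ := hsup e'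
  change b (f (x + y)) (f (x' + y')) = _
  simp only [map_add, hfp x hx, hfq y hy, hfp x' hx', hfq y' hy', LinearMap.add_apply, hg x x',
    hh y y', horth _ (hgp x hx) _ (hhq y' hy'), horth x hx y' hy', hb.eq _ (g x'), hb.eq y x',
    horth _ (hgp x' hx') _ (hhq y hy), horth x' hx' y hy]

theorem neg_mem_orthogonalGroup : LinearEquiv.neg K ∈ orthogonalGroup b := fun u v => by simp

/-- The spaces `ker (1 + u)^n` and `range (1 + u)^n` are orthogonal, for an isometry `u`. -/
theorem orthogonal_ker_pow_range_pow {u : E ≃ₗ[K] E} (hu : u ∈ orthogonalGroup b) (n : ℕ) (x y : E)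
    (hx : ((1 + u.toLinearMap : Module.End K E) ^ n) x = 0) :
    b x (((1 + u.toLinearMap : Module.End K E) ^ n) y) = 0 := by
  induction n generalizing x y with
  | zero =>
    have : x = 0 := hx
    rw [this, map_zero, LinearMap.zero_apply]
  | succ n ih =>
    have hc : Commute (1 + u.toLinearMap : Module.End K E) u.toLinearMap :=
      (Commute.one_left _).add_left (Commute.refl _)
    have h1 : u (((1 + u.toLinearMap : Module.End K E) ^ n) y)
        = ((1 + u.toLinearMap : Module.End K E) ^ n) (u y) :=
      (LinearMap.congr_fun (hc.pow_left n).eq y).symm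
    rw [pow_succ] at hx
    have h2 := ih _ (u y) hx
    rw [pow_succ', Module.End.mul_apply, LinearMap.add_apply, Module.End.one_apply, map_add,
      LinearEquiv.coe_coe, ← hu x]
    rw [← h1] at h2
    simpa [add_comm] using h2

theorem disjoint_orthogonal_and_orthogonal_eq (hb : b.IsSymm) (hnd : b.Nondegenerate)
    {p q : Submodule K E}
    (hpq : IsCompl p q) (horth : ∀ x ∈ p, ∀ y ∈ q, b x y = 0) :
    Disjoint p (b.orthogonal p) ∧ b.orthogonal p = q := by
  have hsup : ∀ e, ∃ x ∈ p, ∃ y ∈ q, x + y = e := fun e =>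
    Submodule.mem_sup.1 (hpq.sup_eq_top ▸ Submodule.mem_top : e ∈ p ⊔ q)
  have hdisj : Disjoint p (b.orthogonal p) := by
    rw [Submodule.disjoint_def]
    intro x hx hx'
    refine hnd.1 x fun e => ?_
    obtain ⟨y, hy, z, hz, rfl⟩ := hsup e
    rw [map_add, horth x hx z hz, hb.eq, hx' y hy, add_zero]
  refine ⟨hdisj, le_antisymm (fun e he => ?_) fun y hy x hx => horth x hx y hy⟩
  obtain ⟨y, hy, z, hz, rfl⟩ := hsup e
  have h1 : y = 0 := Submodule.disjoint_def.1 hdisj y hy (by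
    have := (b.orthogonal p).sub_mem he (fun x hx => horth x hx z hz)
    rwa [add_sub_cancel_right] at this)
  rwa [h1, zero_add]

theorem even_of_neg_one_pow_eq_one {k : ℕ} (h : (-1 : K) ^ k = 1) : Even k := by
  by_contra hk
  rw [Odd.neg_one_pow (Nat.not_even_iff_odd.1 hk)] at h
  norm_num at h

/-- Lifts of commuting isometries `g` and `u` commute if `g` has determinant `1` on every
nondegenerate subspace that is invariant under the centralizer of `u`. With `N` and `R` the Fitting
components of `1 + u`, write `u = u₁ u₂` with `u₁ = -1` on `N` and `u₁ = 1` on `R`. Then `1 + u₂` is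
invertible, and `g` lifts to an even product of vectors of `N` times an even product of vectors of
`R`, all of which commute or anticommute with the lift of `u₁`. -/
theorem commute_of_det_eq_one (hb : b.IsSymm) (hnd : b.Nondegenerate) {g u : E ≃ₗ[K] E}
    (hg : g ∈ orthogonalGroup b) (hu : u ∈ orthogonalGroup b) (hgu : Commute g u)
    (hdet : ∀ (N : Submodule K E) (hN : ∀ x ∈ N, g x ∈ N), Disjoint N (b.orthogonal N) →
      (∀ h : E ≃ₗ[K] E, Commute h u → ∀ x ∈ N, h x ∈ N) →
      LinearMap.det (g.toLinearMap.restrict hN) = 1)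
    {x y : (CliffordAlgebra (halfQuadraticForm b))ˣ} (hx : Lifts b x g) (hy : Lifts b y u) :
    Commute x y := by
  set f : Module.End K E := 1 + u.toLinearMap with hf
  obtain ⟨n, hn, hn1⟩ := ((LinearMap.eventually_isCompl_ker_pow_range_pow f).and
    (Filter.eventually_ge_atTop 1)).exists
  set N := LinearMap.ker (f ^ n) with hNdef
  set R := LinearMap.range (f ^ n) with hRdef
  have hcomm : ∀ h : E ≃ₗ[K] E, Commute h u → ∀ e, h ((f ^ n) e) = (f ^ n) (h e) := by
    intro h hhu e
    have h1 : Commute (h.toLinearMap : Module.End K E) u.toLinearMap :=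
      LinearMap.ext fun e => LinearEquiv.congr_fun hhu.eq e
    exact LinearMap.congr_fun ((((Commute.one_right _).add_right h1).pow_right n).eq) e
  have hinvN : ∀ h : E ≃ₗ[K] E, Commute h u → ∀ x ∈ N, h x ∈ N := fun h hhu x hx => by
    rw [hNdef, LinearMap.mem_ker, ← hcomm h hhu, LinearMap.mem_ker.1 hx, map_zero]
  have hinvR : ∀ h : E ≃ₗ[K] E, Commute h u → ∀ x ∈ R, h x ∈ R := by
    rintro h hhu _ ⟨x, rfl⟩
    exact ⟨h x, (hcomm h hhu x).symm⟩
  have horth : ∀ x ∈ N, ∀ y ∈ R, b x y = 0 := by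
    rintro x hx _ ⟨y, rfl⟩
    exact orthogonal_ker_pow_range_pow hu n x y hx
  have horth' : ∀ x ∈ R, ∀ y ∈ N, b x y = 0 := fun x hx y hy => by
    rw [hb.eq, horth y hy x hx]
  obtain ⟨hN, hNR⟩ := disjoint_orthogonal_and_orthogonal_eq hb hnd hn horth
  obtain ⟨hR, hRN⟩ := disjoint_orthogonal_and_orthogonal_eq hb hnd hn.symm horth'
  have hone : (1 : E ≃ₗ[K] E) ∈ orthogonalGroup b := one_mem _
  obtain ⟨u₁, hu₁, hu₁N, hu₁R⟩ := exists_glue hb hn horth (neg_mem_orthogonalGroup (b := b)) hone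
    (fun x hx => N.neg_mem hx) (fun x hx => hx)
  obtain ⟨gN, hgN, hgNN, hgNR⟩ := exists_glue hb hn horth hg hone (hinvN g hgu) (fun x hx => hx)
  obtain ⟨gR, hgR, hgRN, hgRR⟩ := exists_glue hb hn horth hone hg (fun x hx => hx) (hinvR g hgu)
  have hmul : g = gN * gR := by
    refine linearEquiv_ext_of_isCompl hn (fun x hx => ?_) fun x hx => ?_
    · rw [LinearEquiv.mul_apply, hgRN x hx]
      exact (hgNN x hx).symm
    · rw [LinearEquiv.mul_apply, hgRR x hx]
      exact (hgNR _ (hinvR g hgu x hx)).symm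
  have hdetN := hdet N (hinvN g hgu) hN hinvN
  have hdetg : LinearMap.det g.toLinearMap = 1 := by
    have h1 := hdet ⊤ (fun x _ => Submodule.mem_top) (disjoint_top_orthogonal hb hnd)
      fun _ _ _ _ => Submodule.mem_top
    rw [← h1, ← LinearMap.det_conj _ Submodule.topEquiv]
    rfl
  have hdetR : LinearMap.det (g.toLinearMap.restrict (hinvR g hgu)) = 1 := by
    rw [det_eq_mul_of_isCompl g.toLinearMap hn (hinvN g hgu) (hinvR g hgu), hdetN, one_mul] at hdetg
    exact hdetg
  have hgNdet : LinearMap.det gN.toLinearMap = 1 := by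
    have h1 : ∀ x ∈ N, gN x ∈ N := fun x hx => by rw [hgNN x hx]; exact hinvN g hgu x hx
    have h2 : ∀ x ∈ R, gN x ∈ R := fun x hx => by rw [hgNR x hx]; exact hx
    rw [det_eq_mul_of_isCompl gN.toLinearMap hn h1 h2,
      det_restrict_eq_one_of_forall_eq gN.toLinearMap h2 hgNR, mul_one, ← hdetN]
    exact det_restrict_congr _ _ hgNN
  have hgRdet : LinearMap.det gR.toLinearMap = 1 := by
    have h1 : ∀ x ∈ N, gR x ∈ N := fun x hx => by rw [hgRN x hx]; exact hx
    have h2 : ∀ x ∈ R, gR x ∈ R := fun x hx => by rw [hgRR x hx]; exact hinvR g hgu x hx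
    rw [det_eq_mul_of_isCompl gR.toLinearMap hn h1 h2,
      det_restrict_eq_one_of_forall_eq gR.toLinearMap h1 hgRN, one_mul, ← hdetR]
    exact det_restrict_congr _ _ hgRR
  obtain ⟨k, y₁, hy₁⟩ := exists_isVectorProductLift hb hnd N hN u₁ hu₁ (by rw [hNR]; exact hu₁R)
  obtain ⟨kN, xN, hxN⟩ := exists_isVectorProductLift hb hnd N hN gN hgN (by rw [hNR]; exact hgNR)
  obtain ⟨kR, xR, hxR⟩ := exists_isVectorProductLift hb hnd R hR gR hgR (by rw [hRN]; exact hgRN)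
  have hkN : Even kN := even_of_neg_one_pow_eq_one (hxN.det.symm.trans hgNdet)
  have hkR : Even kR := even_of_neg_one_pow_eq_one (hxR.det.symm.trans hgRdet)
  have hsq : (-1 : K) ^ k * (-1) ^ k = 1 := by rw [← mul_pow]; norm_num
  have hy₁v : ∀ v, (y₁ : CliffordAlgebra (halfQuadraticForm b)) * ι _ v
      = (-1 : K) ^ k • (ι _ (u₁ v) * (y₁ : CliffordAlgebra (halfQuadraticForm b))) := fun v => by
    rw [← hy₁.lifts v, hy₁.involute_eq, smul_mul_assoc, smul_smul, hsq, one_smul]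
  have hcN : (y₁ : CliffordAlgebra (halfQuadraticForm b)) * xN = xN * y₁ := by
    rw [hxN.mul_eq_smul y₁ (-(-1) ^ k) fun v hv => ?_, hkN.neg_pow, ← pow_mul, mul_comm, pow_mul,
      hkN.neg_one_pow, one_pow, one_smul]
    rw [hy₁v, hu₁N v hv, LinearEquiv.neg_apply, map_neg, neg_mul, smul_neg, neg_smul]
  have hcR : (y₁ : CliffordAlgebra (halfQuadraticForm b)) * xR = xR * y₁ := by
    rw [hxR.mul_eq_smul y₁ ((-1) ^ k) fun v hv => ?_, ← pow_mul, mul_comm, pow_mul,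
      hkR.neg_one_pow, one_pow, one_smul]
    rw [hy₁v, hu₁R v hv]
    rfl
  have hxy₁ : Commute x y₁ := by
    rw [hmul] at hx
    obtain ⟨c, hc⟩ := hx.exists_smul hb hnd (hxN.lifts.mul hxR.lifts)
    refine Units.ext ?_
    rw [Units.val_mul, Units.val_mul, hc, Units.val_mul, mul_assoc, mul_assoc, ← hcR,
      ← mul_assoc (xN : CliffordAlgebra (halfQuadraticForm b)), ← hcN, mul_assoc,
      ← mul_assoc (algebraMap K _ c), Algebra.commutes, mul_assoc]
  have hgu₁ : Commute g u₁ := by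
    refine linearEquiv_ext_of_isCompl hn (fun x hx => ?_) fun x hx => ?_
    · rw [LinearEquiv.mul_apply, LinearEquiv.mul_apply, hu₁N x hx, hu₁N _ (hinvN g hgu x hx)]
      simp
    · rw [LinearEquiv.mul_apply, LinearEquiv.mul_apply, hu₁R x hx, hu₁R _ (hinvR g hgu x hx)]
      rfl
  have hcayley : ∀ e, (u₁⁻¹ * u) e = -e → e = 0 := by
    intro e he
    have h1 : u e = -u₁ e := by
      have := congrArg u₁ he
      rwa [LinearEquiv.mul_apply, map_neg,
        show u₁ (u₁⁻¹ (u e)) = u e from u₁.apply_symm_apply _] at this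
    obtain ⟨z, hz, r, hr, rfl⟩ :=
      Submodule.mem_sup.1 (hn.sup_eq_top ▸ Submodule.mem_top : e ∈ N ⊔ R)
    have huu : Commute u u := Commute.refl u
    rw [map_add, map_add, hu₁N z hz, hu₁R r hr] at h1
    have h2 : u z - z = -(u r + r) := by
      have h1' : u z + u r = -(-z + r) := h1
      rw [eq_sub_of_add_eq h1']
      abel
    have h3 : u z - z = 0 := Submodule.disjoint_def.1 hn.disjoint _
      (N.sub_mem (hinvN u huu z hz) hz)
      (h2 ▸ R.neg_mem (R.add_mem (hinvR u huu r hr) hr))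
    have hr0 : r = 0 := by
      refine Submodule.disjoint_def.1 hn.disjoint r ?_ hr
      rw [h3, zero_eq_neg] at h2
      have h4 : f r = 0 := by
        rw [hf, LinearMap.add_apply, Module.End.one_apply, LinearEquiv.coe_coe, add_comm]
        exact h2
      obtain ⟨m, rfl⟩ := Nat.exists_eq_add_of_le' hn1
      rw [hNdef, LinearMap.mem_ker, pow_succ, Module.End.mul_apply, h4, map_zero]
    have hz0 : z = 0 := by
      have h4 : f z = (2 : K) • z := by
        rw [hf, LinearMap.add_apply, Module.End.one_apply, LinearEquiv.coe_coe, sub_eq_zero.1 h3,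
          two_smul]
      have h5 : ∀ m : ℕ, (f ^ m) z = (2 : K) ^ m • z := fun m => by
        induction m with
        | zero => simp
        | succ m ih => rw [pow_succ, Module.End.mul_apply, h4, map_smul, ih, smul_smul, pow_succ']
      have h6 := LinearMap.mem_ker.1 hz
      rw [h5] at h6
      exact (smul_eq_zero.1 h6).resolve_left (pow_ne_zero _ two_ne_zero)
    rw [hr0, hz0, add_zero]
  have hxy₂ : Commute x (y₁⁻¹ * y) :=
    hx.commute_of_cayley hb hnd (hy₁.lifts.inv.mul hy) (hgu₁.inv_right.mul_right hgu) hcayley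
  have := hxy₁.mul_right hxy₂
  rwa [mul_inv_cancel_left] at this

end CommutingLifts

/-! ### Irreducible nondegenerate invariant subspaces -/

section InvariantSubspaces

variable {K E : Type*} [Field K] [CharZero K] [AddCommGroup E] [Module K E]
  [FiniteDimensional K E] {b : LinearMap.BilinForm K E} {G : Subgroup (orthogonalGroup b)}

theorem IsInvariant.inf {U U' : Submodule K E} (hU : IsInvariant (MonoidHom.id _) G U)
    (hU' : IsInvariant (MonoidHom.id _) G U') : IsInvariant (MonoidHom.id _) G (U ⊓ U') :=
  fun g hg u hu => ⟨hU g hg u hu.1, hU' g hg u hu.2⟩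

theorem IsInvariant.sup {U U' : Submodule K E} (hU : IsInvariant (MonoidHom.id _) G U)
    (hU' : IsInvariant (MonoidHom.id _) G U') : IsInvariant (MonoidHom.id _) G (U ⊔ U') := by
  intro g hg u hu
  obtain ⟨x, hx, y, hy, rfl⟩ := Submodule.mem_sup.1 hu
  rw [map_add]
  exact Submodule.add_mem_sup (hU g hg x hx) (hU' g hg y hy)

theorem IsInvariant.orthogonal {U : Submodule K E} (hU : IsInvariant (MonoidHom.id _) G U) :
    IsInvariant (MonoidHom.id _) G (b.orthogonal U) := by
  intro g hg e he u hu
  have h1 := g.2 (g⁻¹.1 u) e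
  rw [show g.1 (g⁻¹.1 u) = u from g.1.apply_symm_apply u] at h1
  exact h1.trans (he _ (hU g⁻¹ (inv_mem hg) u hu))

/-- Splitting off a nondegenerate subspace. -/
theorem sup_inf_orthogonal (hb : b.IsSymm) {M N : Submodule K E}
    (hM : Disjoint M (b.orthogonal M)) (hMN : M ≤ N) : M ⊔ N ⊓ b.orthogonal M = N := by
  refine le_antisymm (sup_le hMN inf_le_left) fun x hx => ?_
  have hc := (LinearMap.BilinForm.isCompl_orthogonal_iff_disjoint hb.isRefl).2 hM
  obtain ⟨y, hy, z, hz, rfl⟩ :=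
    Submodule.mem_sup.1 (hc.sup_eq_top ▸ Submodule.mem_top : x ∈ M ⊔ b.orthogonal M)
  refine Submodule.add_mem_sup hy ⟨?_, hz⟩
  have := N.sub_mem hx (hMN hy)
  rwa [add_sub_cancel_left] at this

theorem disjoint_inf_orthogonal (hb : b.IsSymm) {M N : Submodule K E}
    (hM : Disjoint M (b.orthogonal M)) (hN : Disjoint N (b.orthogonal N)) (hMN : M ≤ N) :
    Disjoint (N ⊓ b.orthogonal M) (b.orthogonal (N ⊓ b.orthogonal M)) := by
  rw [Submodule.disjoint_def]
  intro x hx hx'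
  refine Submodule.disjoint_def.1 hN x hx.1 fun y hy => ?_
  rw [← sup_inf_orthogonal hb hM hMN] at hy
  obtain ⟨z, hz, w, hw, rfl⟩ := Submodule.mem_sup.1 hy
  rw [map_add, LinearMap.add_apply, hx.2 z hz, hx' w hw, add_zero]

theorem finrank_inf_orthogonal_lt {M N : Submodule K E}
    (hM : Disjoint M (b.orthogonal M)) (hMN : M ≤ N) (hM0 : M ≠ ⊥) :
    Module.finrank K (N ⊓ b.orthogonal M : Submodule K E) < Module.finrank K N := by
  refine Submodule.finrank_lt_finrank_of_lt (lt_of_le_of_ne inf_le_left fun h => hM0 ?_)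
  rw [← h] at hMN
  exact disjoint_self.1 (hM.mono_right (hMN.trans inf_le_right))

/-- For an invariant isotropic subspace `X` of a nondegenerate invariant subspace `N`, there is an
invariant subspace `Y` of `N` that `b` pairs perfectly with `X`. Every isometry has determinant `1`
on the nondegenerate subspace `X ⊔ Y`. -/
theorem exists_hyperbolic (hb : b.IsSymm) (hG : ActsReductively (MonoidHom.id _) G)
    {g : orthogonalGroup b} (hg : g ∈ G) {N X : Submodule K E}
    (hN : IsInvariant (MonoidHom.id _) G N) (hNd : Disjoint N (b.orthogonal N))
    (hX : IsInvariant (MonoidHom.id _) G X) (hXN : X ≤ N) (hXX : X ≤ b.orthogonal X) :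
    ∃ (M : Submodule K E) (hM : IsInvariant (MonoidHom.id _) G M), X ≤ M ∧ M ≤ N ∧
      Disjoint M (b.orthogonal M) ∧ LinearMap.det (g.1.toLinearMap.restrict (hM g hg)) = 1 := by
  obtain ⟨C, hC, hcompl⟩ := hG (N ⊓ b.orthogonal X) (hN.inf hX.orthogonal)
  have hsplit : ∀ e ∈ N, ∃ z ∈ b.orthogonal X, ∃ y ∈ C ⊓ N, z + y = e := fun e he => by
    obtain ⟨z, hz, y, hy, rfl⟩ :=
      Submodule.mem_sup.1 (hcompl.sup_eq_top ▸ Submodule.mem_top : e ∈ N ⊓ b.orthogonal X ⊔ C)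
    refine ⟨z, hz.2, y, ⟨hy, ?_⟩, rfl⟩
    have := N.sub_mem he hz.1
    rwa [add_sub_cancel_left] at this
  have hr : ∀ y ∈ C ⊓ N, (∀ x ∈ X, b x y = 0) → y = 0 := fun y hy h =>
    Submodule.disjoint_def.1 hcompl.disjoint y ⟨hy.2, h⟩ hy.1
  have hl : ∀ x ∈ X, (∀ y ∈ C ⊓ N, b x y = 0) → x = 0 := fun x hx h => by
    refine Submodule.disjoint_def.1 hNd x (hXN hx) fun e he => ?_
    obtain ⟨z, hz, y, hy, rfl⟩ := hsplit e he
    rw [hb.eq, map_add, hz x hx, h y hy, add_zero]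
  have hY := hC.inf hN
  have hdisj : Disjoint X (C ⊓ N) := by
    rw [Submodule.disjoint_def]
    exact fun x hx hx' => hr x hx' fun x' hx'' => hXX hx x' hx''
  refine ⟨X ⊔ C ⊓ N, hX.sup hY, le_sup_left, sup_le hXN inf_le_right, ?_, ?_⟩
  · rw [Submodule.disjoint_def]
    intro e he he'
    obtain ⟨x, hx, y, hy, rfl⟩ := Submodule.mem_sup.1 he
    have hy0 : y = 0 := hr y hy fun x' hx' => by
      have h1 := he' x' (Submodule.mem_sup_left hx')
      rwa [map_add, hXX hx x' hx', zero_add] at h1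
    have hx0 : x = 0 := hl x hx fun y' hy' => by
      have h1 := he' y' (Submodule.mem_sup_right hy')
      rwa [hy0, add_zero, hb.eq] at h1
    rw [hx0, hy0, add_zero]
  · rw [det_restrict_eq_mul g.1.toLinearMap hdisj rfl (hX g hg) (hY g hg)]
    refine det_mul_det_of_pairing ((b.domRestrict₁₂ X (C ⊓ N))) ?_ ?_ _ _ ?_
    · exact fun x h => Subtype.ext (hl x x.2 fun y hy => h ⟨y, hy⟩)
    · exact fun y h => Subtype.ext (hr y y.2 fun x hx => h ⟨x, hx⟩)
    · exact fun x y => g.2 x y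

/-- If `g ∈ G` has determinant `≠ 1` on some nondegenerate invariant subspace, it has determinant
`≠ 1` on a nondegenerate invariant subspace that is irreducible. -/
theorem exists_irreducible_det_ne_one (hb : b.IsSymm) (hG : ActsReductively (MonoidHom.id _) G)
    {g : orthogonalGroup b} (hg : g ∈ G) (N : Submodule K E)
    (hN : IsInvariant (MonoidHom.id _) G N) (hNd : Disjoint N (b.orthogonal N))
    (hdet : LinearMap.det (g.1.toLinearMap.restrict (hN g hg)) ≠ 1) :
    ∃ (N : Submodule K E) (hN : IsInvariant (MonoidHom.id _) G N), Disjoint N (b.orthogonal N) ∧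
      LinearMap.det (g.1.toLinearMap.restrict (hN g hg)) ≠ 1 ∧
      ∀ U ≤ N, IsInvariant (MonoidHom.id _) G U → U = ⊥ ∨ U = N := by
  induction hn : Module.finrank K N using Nat.strong_induction_on generalizing N with
  | _ n ih =>
    by_cases hirr : ∀ U ≤ N, IsInvariant (MonoidHom.id _) G U → U = ⊥ ∨ U = N
    · exact ⟨N, hN, hNd, hdet, hirr⟩
    push Not at hirr
    obtain ⟨U, hUN, hU, hU0, hU1⟩ := hirr
    have hdetmul : ∀ (M : Submodule K E) (hM : IsInvariant (MonoidHom.id _) G M) (_ : M ≤ N)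
        (_ : Disjoint M (b.orthogonal M)), LinearMap.det (g.1.toLinearMap.restrict (hN g hg))
          = LinearMap.det (g.1.toLinearMap.restrict (hM g hg)) *
            LinearMap.det (g.1.toLinearMap.restrict ((hN.inf hM.orthogonal) g hg)) :=
      fun M hM hMN hMd => det_restrict_eq_mul _ (hMd.mono_right inf_le_right)
        (sup_inf_orthogonal hb hMd hMN) _ _ _
    -- `U` is nondegenerate, or its radical spans a hyperbolic subspace of determinant `1`.
    by_cases hX : U ⊓ b.orthogonal U = ⊥
    · have hUd : Disjoint U (b.orthogonal U) := disjoint_iff.2 hX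
      by_cases hdU : LinearMap.det (g.1.toLinearMap.restrict (hU g hg)) = 1
      · refine ih _ (hn ▸ finrank_inf_orthogonal_lt hUd hUN hU0) _ (hN.inf hU.orthogonal)
          (disjoint_inf_orthogonal hb hUd hNd hUN) ?_ rfl
        rwa [hdetmul U hU hUN hUd, hdU, one_mul] at hdet
      · exact ih _ (hn ▸ Submodule.finrank_lt_finrank_of_lt (lt_of_le_of_ne hUN hU1)) U hU hUd hdU
          rfl
    · obtain ⟨M, hM, hXM, hMN, hMd, hdM⟩ := exists_hyperbolic hb hG hg hN hNd
        (hU.inf hU.orthogonal) (inf_le_left.trans hUN) (fun x hx y hy => hx.2 y hy.1)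
      have hM0 : M ≠ ⊥ := fun h => hX (le_bot_iff.1 (h ▸ hXM))
      refine ih _ (hn ▸ finrank_inf_orthogonal_lt hMd hMN hM0) _ (hN.inf hM.orthogonal)
        (disjoint_inf_orthogonal hb hMd hNd hMN) ?_ rfl
      rwa [hdetmul M hM hMN hMd, hdM, one_mul] at hdet

end InvariantSubspaces

/-! ### Commutants over the real and complex numbers -/

section Commutants

/-- The real determinant of a `ℂ`-linear map is the squared modulus of its complex determinant. -/
theorem det_nonneg_of_commute_of_sq_eq_neg_one {V : Type*} [AddCommGroup V] [Module ℝ V]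
    [FiniteDimensional ℝ V] {J A : Module.End ℝ V} (hJ : J * J = -1) (hJA : Commute J A) :
    0 ≤ LinearMap.det A := by
  let φ : ℂ →ₐ[ℝ] Module.End ℝ V := Complex.lift ⟨J, hJ⟩
  let _ : Module ℂ V := Module.compHom V φ.toRingHom
  have hsmul : ∀ (z : ℂ) (v : V), z • v = φ z v := fun _ _ => rfl
  have : IsScalarTower ℝ ℂ V := ⟨fun r z v => by rw [hsmul, hsmul, map_smul]; rfl⟩
  have : Module.Finite ℂ V := Module.Finite.of_restrictScalars_finite ℝ ℂ V
  let A' : V →ₗ[ℂ] V :=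
    { toFun := A
      map_add' := map_add A
      map_smul' := fun z v => by
        rw [hsmul, RingHom.id_apply, hsmul]
        simp only [φ, Complex.lift_apply, Complex.liftAux_apply, LinearMap.add_apply,
          LinearMap.smul_apply, map_add, map_smul]
        have := LinearMap.congr_fun hJA.eq v
        simp only [Module.End.mul_apply] at this
        rw [this]
        simp [Module.algebraMap_end_apply] }
  have h : A'.restrictScalars ℝ = A := rfl
  rw [← h, LinearMap.det_restrictScalars, Algebra.norm_complex_apply]
  exact Complex.normSq_nonneg _

/-- An operator over `ℝ` that is a root of an irreducible polynomial and commutes with an operator of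
negative determinant is a scalar, as otherwise it generates a copy of `ℂ`. -/
theorem eq_smul_one_of_aeval_real {V : Type*} [AddCommGroup V] [Module ℝ V]
    [FiniteDimensional ℝ V] {T A : Module.End ℝ V} (hTA : Commute T A) (hA : LinearMap.det A < 0)
    {p : Polynomial ℝ} (hp : Irreducible p) (hpT : Polynomial.aeval T p = 0) :
    ∃ c : ℝ, T = c • 1 := by
  have hdeg := hp.degree_le_two
  obtain ⟨a, c, d, rfl⟩ : ∃ a c d : ℝ, p = Polynomial.C a * Polynomial.X ^ 2
      + Polynomial.C c * Polynomial.X + Polynomial.C d :=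
    ⟨_, _, _, Polynomial.eq_quadratic_of_degree_le_two hdeg⟩
  have hT : a • (T * T) + c • T + d • 1 = 0 := by
    simpa [Algebra.smul_def, pow_two] using hpT
  by_cases ha : a = 0
  · subst ha
    have hc : c ≠ 0 := by
      rintro rfl
      by_cases hd : d = 0
      · simp [hd] at hp
      · exact hp.not_isUnit (by simpa using hd)
    refine ⟨-(c⁻¹ * d), ?_⟩
    have h1 : T = c⁻¹ • (c • T) := by rw [smul_smul, inv_mul_cancel₀ hc, one_smul]
    rw [h1, eq_neg_of_add_eq_zero_left (by simpa using hT : c • T + d • (1 : Module.End ℝ V) = 0),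
      smul_neg, smul_smul, neg_smul]
  · exfalso
    have hdisc : 0 < 4 * a * d - c ^ 2 := by
      by_contra! h
      obtain ⟨x, hx⟩ := exists_quadratic_eq_zero (a := a) (b := c) (c := d) ha
        ⟨Real.sqrt (discrim a c d), by
          rw [Real.mul_self_sqrt]
          rw [discrim]
          linarith⟩
      have hroot : Polynomial.IsRoot (Polynomial.C a * Polynomial.X ^ 2
          + Polynomial.C c * Polynomial.X + Polynomial.C d) x := by
        simp only [Polynomial.IsRoot, Polynomial.eval_add, Polynomial.eval_mul, Polynomial.eval_C,
          Polynomial.eval_pow, Polynomial.eval_X]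
        rw [← hx]
        ring
      have h1 := Polynomial.degree_eq_one_of_irreducible_of_root hp hroot
      rw [Polynomial.degree_quadratic ha] at h1
      norm_num at h1
    set s := Real.sqrt (4 * a * d - c ^ 2) with hs
    have hs2 : s * s = 4 * a * d - c ^ 2 := Real.mul_self_sqrt hdisc.le
    have hs0 : s ≠ 0 := (Real.sqrt_pos.2 hdisc).ne'
    -- Completing the square in `a T² + c T + d = 0` yields a square root of `-1`.
    have hJ : (s⁻¹ • ((2 * a) • T + c • 1)) * (s⁻¹ • ((2 * a) • T + c • 1))
        = (-1 : Module.End ℝ V) := by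
      have h1 : ((2 * a) • T + c • 1) * ((2 * a) • T + c • 1)
          = (4 * a) • (a • (T * T) + c • T + d • 1) - (s * s) • (1 : Module.End ℝ V) := by
        rw [hs2]
        simp only [mul_add, add_mul, smul_mul_smul_comm, mul_one, one_mul]
        module
      rw [smul_mul_smul_comm, h1, hT, smul_zero, zero_sub, smul_neg, smul_smul,
        show s⁻¹ * s⁻¹ * (s * s) = 1 by field_simp, one_smul]
    refine absurd (det_nonneg_of_commute_of_sq_eq_neg_one hJ ?_) (not_le.2 hA)
    exact ((hTA.smul_left _).add_left ((Commute.one_left A).smul_left _)).smul_left _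

theorem eq_smul_one_of_aeval_of_isAlgClosed {K V : Type*} [Field K] [IsAlgClosed K]
    [AddCommGroup V] [Module K V] {T : Module.End K V}
    {p : Polynomial K} (hp : Irreducible p) (hpT : Polynomial.aeval T p = 0) :
    ∃ c : K, T = c • 1 := by
  have hdeg := IsAlgClosed.degree_eq_one_of_irreducible K hp
  rw [Polynomial.eq_X_add_C_of_degree_eq_one hdeg] at hpT
  have hc : p.leadingCoeff ≠ 0 := Polynomial.leadingCoeff_ne_zero.2 hp.ne_zero
  refine ⟨-(p.leadingCoeff⁻¹ * p.coeff 0), ?_⟩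
  have h1 : p.leadingCoeff • T + p.coeff 0 • 1 = 0 := by
    simpa [Algebra.smul_def] using hpT
  have h2 : T = p.leadingCoeff⁻¹ • (p.leadingCoeff • T) := by
    rw [smul_smul, inv_mul_cancel₀ hc, one_smul]
  rw [h2, eq_neg_of_add_eq_zero_left h1, smul_neg, smul_smul, neg_smul]

end Commutants

/-! ### Isotypic components of irreducible subspaces with scalar commutant -/

section IsotypicComponent

variable {K E : Type*} [Field K] [CharZero K] [AddCommGroup E] [Module K E]
  [FiniteDimensional K E] {b : LinearMap.BilinForm K E} {G G' : Subgroup (orthogonalGroup b)}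

theorem exists_orthogonalGroup_congr {U U' : Type*} [AddCommGroup U] [Module K U]
    [AddCommGroup U'] [Module K U'] (B : LinearMap.BilinForm K U) (s : U' ≃ₗ[K] U)
    {P : (U → U) → Prop} :
    (∃ a ∈ orthogonalGroup B, P a) ↔
      ∃ a ∈ orthogonalGroup (LinearMap.BilinForm.congr s.symm B),
        P (fun u => s (a (s.symm u))) := by
  constructor
  · rintro ⟨a, ha, h⟩
    refine ⟨s.trans (a.trans s.symm), fun u v => ?_, ?_⟩
    · simpa using ha (s u) (s v)
    · simpa using h
  · rintro ⟨a, ha, h⟩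
    refine ⟨s.symm.trans (a.trans s), fun u v => ?_, h⟩
    simpa using ha (s.symm u) (s.symm v)

/-- `IsOrthogonalPair` with arbitrary spaces `V` and `W` in place of coordinate spaces. -/
theorem isOrthogonalPair_of_equiv {V W : Type*} [AddCommGroup V] [Module K V]
    [FiniteDimensional K V] [AddCommGroup W] [Module K W] [FiniteDimensional K W]
    (bV : LinearMap.BilinForm K V) (bW : LinearMap.BilinForm K W) (φ : V ⊗[K] W ≃ₗ[K] E)
    (hV : bV.IsSymm) (hVn : bV.Nondegenerate) (hW : bW.IsSymm) (hWn : bW.Nondegenerate)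
    (hφ : ∀ v w v' w', b (φ (v ⊗ₜ[K] w)) (φ (v' ⊗ₜ[K] w')) = bV v v' * bW w w')
    (hG : ∀ g : orthogonalGroup b, g ∈ G ↔
      ∃ a ∈ orthogonalGroup bV, ∀ v w, (g : E ≃ₗ[K] E) (φ (v ⊗ₜ[K] w)) = φ (a v ⊗ₜ[K] w))
    (hG' : ∀ g : orthogonalGroup b, g ∈ G' ↔
      ∃ a ∈ orthogonalGroup bW, ∀ v w, (g : E ≃ₗ[K] E) (φ (v ⊗ₜ[K] w)) = φ (v ⊗ₜ[K] a w)) :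
    IsOrthogonalPair G G' := by
  let e : (Fin (Module.finrank K V) → K) ≃ₗ[K] V := (Module.finBasis K V).equivFun.symm
  let e' : (Fin (Module.finrank K W) → K) ≃ₗ[K] W := (Module.finBasis K W).equivFun.symm
  refine ⟨_, _, bV.congr e.symm, bW.congr e'.symm, (TensorProduct.congr e e').trans φ,
    ⟨fun x y => hV.eq _ _⟩, (LinearMap.BilinForm.nondegenerate_congr_iff _).2 hVn,
    ⟨fun x y => hW.eq _ _⟩, (LinearMap.BilinForm.nondegenerate_congr_iff _).2 hWn,
    fun v w v' w' => hφ _ _ _ _, fun g => ?_, fun g => ?_⟩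
  · rw [hG, exists_orthogonalGroup_congr bV e
      (P := fun f => ∀ v w, (g : E ≃ₗ[K] E) (φ (v ⊗ₜ[K] w)) = φ (f v ⊗ₜ[K] w))]
    refine exists_congr fun a => and_congr_right fun _ => ⟨fun h v w => ?_, fun h v w => ?_⟩
    · simpa using h (e v) (e' w)
    · simpa using h (e.symm v) (e'.symm w)
  · rw [hG', exists_orthogonalGroup_congr bW e'
      (P := fun f => ∀ v w, (g : E ≃ₗ[K] E) (φ (v ⊗ₜ[K] w)) = φ (v ⊗ₜ[K] f w))]
    refine exists_congr fun a => and_congr_right fun _ => ⟨fun h v w => ?_, fun h v w => ?_⟩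
    · simpa using h (e v) (e' w)
    · simpa using h (e.symm v) (e'.symm w)

/-- The space `Hom_G(N, E)` of equivariant maps from an invariant subspace `N` to `E`. -/
def equivariantMaps {N : Submodule K E} (hN : IsInvariant (MonoidHom.id _) G N) :
    Submodule K (N →ₗ[K] E) where
  carrier := {φ | ∀ g (hg : g ∈ G) x, φ (g.1.toLinearMap.restrict (hN g hg) x) = g.1 (φ x)}
  add_mem' hφ hψ g hg x := by
    rw [LinearMap.add_apply, LinearMap.add_apply, map_add, hφ g hg, hψ g hg]
  zero_mem' g hg x := by rw [LinearMap.zero_apply, LinearMap.zero_apply, map_zero]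
  smul_mem' c φ hφ g hg x := by
    rw [LinearMap.smul_apply, LinearMap.smul_apply, map_smul, hφ g hg]

variable {N : Submodule K E} (hN : IsInvariant (MonoidHom.id _) G N)

theorem exists_restrict_eq {g : orthogonalGroup b} (hg : g ∈ G) (y : N) :
    ∃ x, g.1.toLinearMap.restrict (hN g hg) x = y :=
  ⟨⟨g⁻¹.1 y, hN g⁻¹ (inv_mem hg) y y.2⟩, Subtype.ext (g.1.apply_symm_apply (y : E))⟩

/-- Schur's lemma for forms: if the commutant of `N` is reduced to scalars, then an invariant
bilinear form on `N` is a multiple of `b`. -/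
theorem exists_eq_mul_of_invariant (hb : b.IsSymm) (hNd : Disjoint N (b.orthogonal N))
    (hscal : ∀ T : N →ₗ[K] N, (∀ g (hg : g ∈ G) x,
      T (g.1.toLinearMap.restrict (hN g hg) x) = g.1.toLinearMap.restrict (hN g hg) (T x)) →
      ∃ c : K, ∀ x, T x = c • x)
    (B : N →ₗ[K] N →ₗ[K] K) (hB : ∀ g (hg : g ∈ G) x y,
      B (g.1.toLinearMap.restrict (hN g hg) x) (g.1.toLinearMap.restrict (hN g hg) y) = B x y) :
    ∃ c : K, ∀ x y : N, B x y = c * b x y := by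
  have hnd := b.nondegenerate_restrict_of_disjoint_orthogonal hb.isRefl hNd
  let T : N →ₗ[K] N := ((b.restrict N).toDual hnd).symm.toLinearMap ∘ₗ B
  have hT : ∀ x y : N, b (T x) y = B x y := fun x y =>
    LinearMap.BilinForm.apply_toDual_symm_apply (hB := hnd) (B x) y
  obtain ⟨c, hc⟩ := hscal T fun g hg x => by
    refine sub_eq_zero.1 (hnd.1 _ fun y => ?_)
    obtain ⟨y, rfl⟩ := exists_restrict_eq hN hg y
    rw [map_sub, LinearMap.sub_apply, sub_eq_zero]
    change b (T _) (g.1.toLinearMap.restrict (hN g hg) y) = b (g.1 (T x)) (g.1 y)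
    rw [g.2, hT, hT, hB g hg]
  exact ⟨c, fun x y => by rw [← hT, hc, Submodule.coe_smul, map_smul, LinearMap.smul_apply,
    smul_eq_mul]⟩

/-- Schur's lemma: a nonzero equivariant map from an irreducible subspace is injective. -/
theorem injective_of_mem_equivariantMaps
    (hirr : ∀ U ≤ N, IsInvariant (MonoidHom.id _) G U → U = ⊥ ∨ U = N)
    {φ : N →ₗ[K] E} (hφ : φ ∈ equivariantMaps hN) (hφ0 : φ ≠ 0) : Function.Injective φ := by
  rw [← LinearMap.ker_eq_bot]
  rcases hirr ((LinearMap.ker φ).map N.subtype) (Submodule.map_subtype_le _ _) (by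
    rintro g hg _ ⟨x, hx, rfl⟩
    refine ⟨g.1.toLinearMap.restrict (hN g hg) x, ?_, rfl⟩
    rw [SetLike.mem_coe, LinearMap.mem_ker, hφ g hg, LinearMap.mem_ker.1 hx, map_zero])
    with h | h
  · rw [eq_bot_iff]
    intro x hx
    have h1 : (x : E) ∈ (LinearMap.ker φ).map N.subtype := ⟨x, hx, rfl⟩
    rw [h] at h1
    exact Subtype.ext h1
  · refine absurd (LinearMap.ext fun x => ?_) hφ0
    obtain ⟨y, hy, hyx⟩ := h.ge x.2
    rw [← Subtype.ext hyx]
    exact hy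

/-- An equivariant embedding of an irreducible subspace `N` pairs nontrivially with another one: the
adjoint of an equivariant left inverse. -/
theorem exists_adjoint_equivariant (hb : b.IsSymm) (hnd : b.Nondegenerate)
    (hG : ActsReductively (MonoidHom.id _) G)
    (hirr : ∀ U ≤ N, IsInvariant (MonoidHom.id _) G U → U = ⊥ ∨ U = N)
    {φ : N →ₗ[K] E} (hφ : φ ∈ equivariantMaps hN) (hφ0 : φ ≠ 0) :
    ∃ ψ ∈ equivariantMaps hN, ∀ x y : N, b (φ x) (ψ y) = b x y := by
  have hinj := injective_of_mem_equivariantMaps hN hirr hφ hφ0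
  have hX : IsInvariant (MonoidHom.id _) G (LinearMap.range φ) := by
    rintro g hg _ ⟨x, rfl⟩
    exact ⟨_, hφ g hg x⟩
  obtain ⟨C, hC, hcompl⟩ := hG _ hX
  let p : E →ₗ[K] N := (LinearEquiv.ofInjective φ hinj).symm.toLinearMap ∘ₗ
    (LinearMap.range φ).projectionOnto C hcompl
  have hpφ : ∀ x, p (φ x) = x := fun x => by
    change (LinearEquiv.ofInjective φ hinj).symm
      ((LinearMap.range φ).projectionOnto C hcompl (LinearEquiv.ofInjective φ hinj x : E)) = x
    rw [Submodule.projectionOnto_apply_left, LinearEquiv.symm_apply_apply]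
  have hpC : ∀ c ∈ C, p c = 0 := fun c hc => by
    change (LinearEquiv.ofInjective φ hinj).symm
      ((LinearMap.range φ).projectionOnto C hcompl (⟨c, hc⟩ : C)) = 0
    rw [Submodule.projectionOnto_apply_right, map_zero]
  have hp : ∀ g (hg : g ∈ G) e, p (g.1 e) = g.1.toLinearMap.restrict (hN g hg) (p e) := by
    intro g hg e
    obtain ⟨_, ⟨x, rfl⟩, c, hc, rfl⟩ :=
      Submodule.mem_sup.1 (hcompl.sup_eq_top ▸ Submodule.mem_top : e ∈ LinearMap.range φ ⊔ C)
    have h1 : p (g.1 c) = 0 := hpC _ (hC g hg c hc)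
    rw [map_add, map_add, map_add, hpφ, hpC c hc, ← hφ g hg, hpφ, h1, add_zero, add_zero]
  let ψ : N →ₗ[K] E := (b.toDual hnd).symm.toLinearMap ∘ₗ
    (LinearMap.lcomp K K p) ∘ₗ (b.restrict N)
  have hψ : ∀ (y : N) (e : E), b (ψ y) e = b y (p e) := fun y e =>
    LinearMap.BilinForm.apply_toDual_symm_apply (hB := hnd) _ e
  refine ⟨ψ, fun g hg y => ?_, fun x y => ?_⟩
  · refine sub_eq_zero.1 (hnd.1 _ fun e => ?_)
    obtain ⟨e, rfl⟩ := g.1.surjective e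
    rw [map_sub, LinearMap.sub_apply, sub_eq_zero, g.2, hψ, hψ, hp g hg]
    exact g.2 y (p e)
  · rw [hb.eq, hψ, hpφ, hb.eq]

/-- The heart of the matter. If `E` contains a nondegenerate irreducible `G`-invariant subspace `N`
whose commutant is reduced to scalars, then the `N`-isotypic component `N ⊗ Hom_G(N, E)` is
nondegenerate and invariant under `G` and `G'`, hence is all of `E`, and the pair is
`(O(N), O(Hom_G(N, E)))`. -/
theorem isOrthogonalPair_of_scalar_commutant (hb : b.IsSymm) (hnd : b.Nondegenerate)
    (hpair : IsIrreducibleDualPair (MonoidHom.id _) G G')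
    (hG : ActsReductively (MonoidHom.id _) G) (hNd : Disjoint N (b.orthogonal N)) (hN0 : N ≠ ⊥)
    (hirr : ∀ U ≤ N, IsInvariant (MonoidHom.id _) G U → U = ⊥ ∨ U = N)
    (hscal : ∀ T : N →ₗ[K] N, (∀ g (hg : g ∈ G) x,
      T (g.1.toLinearMap.restrict (hN g hg) x) = g.1.toLinearMap.restrict (hN g hg) (T x)) →
      ∃ c : K, ∀ x, T x = c • x) :
    IsOrthogonalPair G G' ∧ ∃ m : ℕ, Module.finrank K E = m * Module.finrank K N ∧
      ∀ g (hg : g ∈ G), LinearMap.det g.1.toLinearMap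
        = LinearMap.det (g.1.toLinearMap.restrict (hN g hg)) ^ m := by
  have hcomm : ∀ g ∈ G, ∀ g' ∈ G', ∀ e, g.1 (g'.1 e) = g'.1 (g.1 e) := fun g hg g' hg' e => by
    rw [← hpair.1.2] at hg'
    exact LinearEquiv.congr_fun (congrArg Subtype.val (Subgroup.mem_centralizer_iff.1 hg' g hg)) e
  have hmemG : ∀ g, (∀ g' ∈ G', ∀ e, g'.1 (g.1 e) = g.1 (g'.1 e)) → g ∈ G := fun g h => by
    rw [← hpair.1.1]
    exact Subgroup.mem_centralizer_iff.2 fun g' hg' => Subtype.ext (LinearEquiv.ext (h g' hg'))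
  have hmemG' : ∀ g', (∀ g ∈ G, ∀ e, g.1 (g'.1 e) = g'.1 (g.1 e)) → g' ∈ G' := fun g' h => by
    rw [← hpair.1.2]
    exact Subgroup.mem_centralizer_iff.2 fun g hg => Subtype.ext (LinearEquiv.ext (h g hg))
  obtain ⟨x₀, hx₀N, hx₀⟩ := exists_anisotropic_of_disjoint hb hNd hN0
  set W := equivariantMaps hN
  let ev₀ : W →ₗ[K] E := (LinearMap.applyₗ (⟨x₀, hx₀N⟩ : N)) ∘ₗ W.subtype
  let bW : LinearMap.BilinForm K W := (b x₀ x₀)⁻¹ • b.compl₁₂ ev₀ ev₀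
  have hbW' : ∀ φ ψ : W, bW φ ψ = (b x₀ x₀)⁻¹ * b (φ.1 ⟨x₀, hx₀N⟩) (ψ.1 ⟨x₀, hx₀N⟩) :=
    fun _ _ => rfl
  have hbW : ∀ (φ ψ : W) (x y : N), b (φ.1 x) (ψ.1 y) = bW φ ψ * b x y := by
    intro φ ψ
    obtain ⟨c, hc⟩ := exists_eq_mul_of_invariant hN hb hNd hscal (b.compl₁₂ φ.1 ψ.1)
      (fun g hg x y => by
        rw [LinearMap.compl₁₂_apply, LinearMap.compl₁₂_apply, φ.2 g hg, ψ.2 g hg, g.2])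
    have h1 := hc ⟨x₀, hx₀N⟩ ⟨x₀, hx₀N⟩
    rw [LinearMap.compl₁₂_apply] at h1
    rw [hbW', h1, mul_comm c, inv_mul_cancel_left₀ hx₀]
    exact hc
  have hbWs : bW.IsSymm := ⟨fun φ ψ => by rw [hbW', hbW', hb.eq (φ.1 _)]⟩
  have hbWn : bW.Nondegenerate := by
    have hsep : ∀ φ : W, (∀ ψ, bW φ ψ = 0) → φ = 0 := by
      intro φ h
      by_contra hφ
      obtain ⟨ψ, hψ, hφψ⟩ := exists_adjoint_equivariant hN hb hnd hG hirr φ.2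
        (fun h => hφ (Subtype.ext h))
      have h1 := hφψ ⟨x₀, hx₀N⟩ ⟨x₀, hx₀N⟩
      rw [hbW φ ⟨ψ, hψ⟩, h, zero_mul] at h1
      exact hx₀ h1.symm
    exact ⟨hsep, fun φ h => hsep φ fun ψ => by rw [hbWs.eq]; exact h ψ⟩
  set m := Module.finrank K W
  let e : Module.Basis (Fin m) K W := Module.finBasis K W
  obtain ⟨e', hd⟩ : ∃ e' : Fin m → W, ∀ i j, bW (e' i) (e j) = if j = i then 1 else 0 :=
    ⟨bW.dualBasis hbWn e, LinearMap.BilinForm.apply_dualBasis_left hbWn e⟩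
  -- In coordinates, the evaluation map `N ⊗ W → E` becomes `S : N ^ m → E`.
  let S : (Fin m → N) →ₗ[K] E := ∑ j, (e j).1 ∘ₗ LinearMap.proj j
  have hS : ∀ x, S x = ∑ j, (e j).1 (x j) := fun x => by simp [S]
  have hdual : ∀ i (y : N) x, b ((e' i).1 y) (S x) = b y (x i) := by
    intro i y x
    rw [hS, map_sum, Finset.sum_eq_single i]
    · rw [hbW, hd, if_pos rfl, one_mul]
    · intro j _ hj
      rw [hbW, hd, if_neg hj, zero_mul]
    · exact fun h => absurd (Finset.mem_univ i) h
  have hzero : ∀ x : Fin m → N, (∀ i (y : N), b ((e' i).1 y) (S x) = 0) → x = 0 := by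
    intro x h
    funext i
    refine Subtype.ext (Submodule.disjoint_def.1 hNd _ (x i).2 fun y hy => ?_)
    rw [← hdual i ⟨y, hy⟩ x]
    exact h i ⟨y, hy⟩
  have hSinj : Function.Injective S := by
    rw [injective_iff_map_eq_zero]
    exact fun x hx => hzero x fun i y => by rw [hx, map_zero]
  have hSW : ∀ φ ∈ W, ∀ x, φ x ∈ LinearMap.range S := by
    intro φ hφ x
    refine ⟨fun j => e.repr ⟨φ, hφ⟩ j • x, ?_⟩
    rw [hS]
    have h1 : W.subtype (∑ j, e.repr ⟨φ, hφ⟩ j • e j) x = φ x := by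
      rw [e.sum_repr]
      rfl
    rw [map_sum, LinearMap.sum_apply] at h1
    exact (Finset.sum_congr rfl fun j _ => map_smul (e j).1 _ x).trans h1
  have hSd : Disjoint (LinearMap.range S) (b.orthogonal (LinearMap.range S)) := by
    rw [Submodule.disjoint_def]
    rintro _ ⟨x, rfl⟩ h
    rw [hzero x fun i y => h _ (hSW _ (e' i).2 y), map_zero]
  have hSG : ∀ g (hg : g ∈ G) x,
      S (fun j => g.1.toLinearMap.restrict (hN g hg) (x j)) = g.1 (S x) := by
    intro g hg x
    rw [hS, hS, map_sum]
    exact Finset.sum_congr rfl fun j _ => (e j).2 g hg (x j)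
  have hIG : IsInvariant (MonoidHom.id _) G (LinearMap.range S) := by
    rintro g hg _ ⟨x, rfl⟩
    exact ⟨_, hSG g hg x⟩
  have hWG' : ∀ g' ∈ G', ∀ φ ∈ W, g'.1.toLinearMap ∘ₗ φ ∈ W := by
    intro g' hg' φ hφ g hg x
    rw [LinearMap.comp_apply, LinearMap.comp_apply, hφ g hg]
    exact (hcomm g hg g' hg' _).symm
  have hIG' : IsInvariant (MonoidHom.id _) G' (LinearMap.range S) := by
    rintro g' hg' _ ⟨x, rfl⟩
    rw [hS, map_sum]
    exact Submodule.sum_mem _ fun j _ => hSW _ (hWG' g' hg' _ (e j).2) (x j)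
  have hSsurj : Function.Surjective S := by
    have hc := (LinearMap.BilinForm.isCompl_orthogonal_iff_disjoint hb.isRefl).2 hSd
    rw [← LinearMap.range_eq_top]
    rcases hpair.2 _ _ hc (fun u hu v hv => hv u hu) hIG hIG' hIG.orthogonal hIG'.orthogonal
      with h | h
    · have h1 : x₀ ∈ LinearMap.range S := hSW N.subtype (fun g hg x => rfl) ⟨x₀, hx₀N⟩
      rw [h, Submodule.mem_bot] at h1
      rw [h1, map_zero] at hx₀
      exact absurd rfl hx₀
    · have h1 := hc.sup_eq_top
      rwa [h, sup_bot_eq] at h1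
  let Se : (Fin m → N) ≃ₗ[K] E := LinearEquiv.ofBijective S ⟨hSinj, hSsurj⟩
  have hdim : Module.finrank K E = m * Module.finrank K N := by
    rw [← Se.finrank_eq, Module.finrank_pi_fintype]
    simp
  refine ⟨?_, m, hdim, fun g hg => ?_⟩
  · let ev : N ⊗[K] W →ₗ[K] E := TensorProduct.lift W.subtype.flip
    have hev : ∀ (x : N) (φ : W), ev (x ⊗ₜ[K] φ) = φ.1 x := fun x φ => rfl
    have hevs : Function.Surjective ev := by
      intro v
      obtain ⟨x, rfl⟩ := hSsurj v
      exact ⟨∑ j, x j ⊗ₜ[K] e j, by rw [map_sum, hS]; exact Finset.sum_congr rfl fun j _ => hev _ _⟩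
    have hevi : Function.Injective ev :=
      (LinearMap.injective_iff_surjective_of_finrank_eq_finrank (by
        rw [Module.finrank_tensorProduct, hdim, mul_comm])).2 hevs
    let evE : N ⊗[K] W ≃ₗ[K] E := LinearEquiv.ofBijective ev ⟨hevi, hevs⟩
    have hevE : ∀ (x : N) (φ : W), evE (x ⊗ₜ[K] φ) = φ.1 x := fun x φ => rfl
    have hspan : ∀ (f h : E →ₗ[K] E), (∀ (x : N) (φ : W), f (φ.1 x) = h (φ.1 x)) → f = h := by
      intro f h hfh
      refine LinearMap.ext fun v => ?_
      obtain ⟨x, rfl⟩ := hSsurj v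
      rw [hS, map_sum, map_sum]
      exact Finset.sum_congr rfl fun j _ => hfh (x j) (e j)
    refine isOrthogonalPair_of_equiv (b.restrict N) bW evE
      ⟨fun x y => hb.eq _ _⟩ (b.nondegenerate_restrict_of_disjoint_orthogonal hb.isRefl hNd)
      hbWs hbWn (fun x φ y ψ => ?_) (fun g => ⟨fun hg => ?_, ?_⟩) (fun g' => ⟨fun hg' => ?_, ?_⟩)
    · rw [hevE, hevE, hbW, mul_comm]
      rfl
    · refine ⟨LinearEquiv.ofInjectiveEndo (g.1.toLinearMap.restrict (hN g hg)) fun x y h =>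
        Subtype.ext (g.1.injective (congrArg Subtype.val h)), fun x y => g.2 x y, fun x φ => ?_⟩
      rw [hevE, hevE]
      exact (φ.2 g hg x).symm
    · rintro ⟨a, -, ha⟩
      refine hmemG g fun g' hg' => LinearMap.congr_fun
        (hspan (g'.1.toLinearMap ∘ₗ g.1.toLinearMap) (g.1.toLinearMap ∘ₗ g'.1.toLinearMap) ?_)
      intro x φ
      have h1 := ha x φ
      have h2 := ha x ⟨_, hWG' g' hg' φ.1 φ.2⟩
      rw [hevE, hevE] at h1 h2
      exact (congrArg g'.1 h1).trans h2.symm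
    · let A : W →ₗ[K] W := ((LinearMap.lcomp K E (LinearMap.id : N →ₗ[K] N)) ∘ₗ
        (LinearMap.llcomp K N E E g'.1.toLinearMap)).restrict (hWG' g' hg')
      have hA : ∀ φ x, (A φ).1 x = g'.1 (φ.1 x) := fun _ _ => rfl
      refine ⟨LinearEquiv.ofInjectiveEndo A fun φ ψ h => Subtype.ext (LinearMap.ext fun x =>
        g'.1.injective ?_), fun φ ψ => ?_, fun x φ => ?_⟩
      · rw [← hA, ← hA, h]
      · change bW (A φ) (A ψ) = _
        rw [hbW', hbW', hA, hA, g'.2]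
      · rfl
    · rintro ⟨a, -, ha⟩
      refine hmemG' g' fun g hg => LinearMap.congr_fun
        (hspan (g.1.toLinearMap ∘ₗ g'.1.toLinearMap) (g'.1.toLinearMap ∘ₗ g.1.toLinearMap) ?_)
      intro x φ
      have h1 := ha x φ
      have h2 := ha (g.1.toLinearMap.restrict (hN g hg) x) φ
      rw [hevE, hevE] at h1 h2
      rw [φ.2 g hg, (a φ).2 g hg] at h2
      exact (congrArg g.1 h1).trans h2.symm
  · rw [← LinearMap.det_conj _ Se.symm]
    have h1 : Se.symm.toLinearMap ∘ₗ g.1.toLinearMap ∘ₗ Se.symm.symm.toLinearMap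
        = LinearMap.pi fun j => g.1.toLinearMap.restrict (hN g hg) ∘ₗ LinearMap.proj j := by
      refine LinearMap.ext fun x => ?_
      rw [LinearMap.comp_apply, LinearEquiv.coe_coe, LinearEquiv.symm_apply_eq]
      exact (hSG g hg x).symm
    rw [h1, LinearMap.det_pi]
    simp

end IsotypicComponent

/-! ### Preimages of dual pairs in the Pin group -/

section CommutingPreimages

variable {K E : Type*} [Field K] [CharZero K] [AddCommGroup E] [Module K E]
  [FiniteDimensional K E] {b : LinearMap.BilinForm K E} {G G' : Subgroup (orthogonalGroup b)}

theorem commute_aeval_left {A : Type*} [Ring A] [Algebra K A] {T R : A} (h : Commute T R)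
    (p : Polynomial K) : Commute (Polynomial.aeval T p) R := by
  induction p using Polynomial.induction_on' with
  | add p q hp hq => rw [map_add]; exact hp.add_left hq
  | monomial n a =>
    rw [Polynomial.aeval_monomial]
    exact (Algebra.commute_algebraMap_left a R).mul_left (h.pow_left n)

/-- The commutant of an irreducible subspace is a division algebra, so each of its elements is a root
of an irreducible polynomial. -/
theorem exists_irreducible_aeval_eq_zero {N : Submodule K E}
    (hN : IsInvariant (MonoidHom.id _) G N) (hN0 : N ≠ ⊥)
    (hirr : ∀ U ≤ N, IsInvariant (MonoidHom.id _) G U → U = ⊥ ∨ U = N) (T : Module.End K N)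
    (hT : ∀ g (hg : g ∈ G), Commute T (g.1.toLinearMap.restrict (hN g hg))) :
    ∃ p : Polynomial K, Irreducible p ∧ Polynomial.aeval T p = 0 := by
  have : Nontrivial N := Submodule.nontrivial_iff_ne_bot.2 hN0
  have hint : IsIntegral K T := Algebra.IsIntegral.isIntegral T
  obtain ⟨p, hp, q, hpq⟩ :=
    WfDvdMonoid.exists_irreducible_factor (minpoly.not_isUnit K T) (minpoly.ne_zero hint)
  refine ⟨p, hp, ?_⟩
  by_contra hp0
  have hinj : Function.Injective (N.subtype ∘ₗ Polynomial.aeval T p) := by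
    refine injective_of_mem_equivariantMaps hN hirr (fun g hg x => ?_) fun h => hp0 ?_
    · exact congrArg Subtype.val (LinearMap.congr_fun (commute_aeval_left (hT g hg) p).eq x)
    · exact LinearMap.ext fun x => Subtype.ext (LinearMap.congr_fun h x)
  have hq : Polynomial.aeval T q = 0 := by
    refine LinearMap.ext fun x => hinj ?_
    have h1 := minpoly.aeval K T
    rw [hpq, map_mul] at h1
    have h2 := congrArg Subtype.val (LinearMap.congr_fun h1 x)
    rw [LinearMap.zero_apply, map_zero]
    exact h2
  have hdvd := minpoly.dvd K T hq
  have hq0 : q ≠ 0 := by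
    rintro rfl
    rw [mul_zero] at hpq
    exact minpoly.ne_zero hint hpq
  obtain ⟨r, hr⟩ := hdvd
  rw [hpq, mul_right_comm, mul_comm] at hr
  exact hp.not_isUnit
    (IsUnit.of_mul_eq_one r (mul_left_cancel₀ hq0 (hr.symm.trans (mul_one q).symm)))

/-- Elements of determinant `≠ 1` exist on invariant nondegenerate subspaces only for orthogonal
pairs. The hypothesis `hK` on the field `K` turns the commutant of an irreducible subspace on which
some `g` has determinant `-1` into the scalars. -/
theorem isOrthogonalPair_of_det_ne_one (hb : b.IsSymm) (hnd : b.Nondegenerate)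
    (hK : ∀ (N : Submodule K E) (T A : Module.End K N), Commute T A → LinearMap.det A = -1 →
      ∀ p : Polynomial K, Irreducible p → Polynomial.aeval T p = 0 → ∃ c : K, T = c • 1)
    (hpair : IsIrreducibleReductiveDualPair G G') {g : orthogonalGroup b} (hg : g ∈ G)
    (N : Submodule K E) (hN : IsInvariant (MonoidHom.id _) G N)
    (hNd : Disjoint N (b.orthogonal N))
    (hdet : LinearMap.det (g.1.toLinearMap.restrict (hN g hg)) ≠ 1) :
    IsOrthogonalPair G G' ∧
      (LinearMap.det g.1.toLinearMap = 1 → Even (Module.finrank K E)) := by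
  obtain ⟨N, hN, hNd, hdet, hirr⟩ := exists_irreducible_det_ne_one hb hpair.2.1 hg N hN hNd hdet
  have hN0 : N ≠ ⊥ := by
    rintro rfl
    exact hdet (det_restrict_eq_one_of_forall_eq _ _ fun x hx => by
      rw [(Submodule.mem_bot K).1 hx, map_zero])
  have hneg : LinearMap.det (g.1.toLinearMap.restrict (hN g hg)) = -1 := by
    have hr := b.nondegenerate_restrict_of_disjoint_orthogonal hb.isRefl hNd
    exact (mul_self_eq_one_iff.1 (det_mul_det_of_pairing (b.restrict N) hr.1 hr.2 _ _
      fun x y => g.2 x y)).resolve_left hdet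
  obtain ⟨horth, m, hm, hdetm⟩ := isOrthogonalPair_of_scalar_commutant hN hb hnd hpair.1 hpair.2.1
    hNd hN0 hirr fun T hT => by
      have hT' : ∀ g (hg : g ∈ G), Commute T (g.1.toLinearMap.restrict (hN g hg)) :=
        fun g hg => LinearMap.ext fun x => hT g hg x
      obtain ⟨p, hp, hpT⟩ := exists_irreducible_aeval_eq_zero hN hN0 hirr T hT'
      obtain ⟨c, hc⟩ := hK N T _ (hT' g hg) hneg p hp hpT
      exact ⟨c, fun x => by rw [hc]; rfl⟩
  refine ⟨horth, fun h => ?_⟩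
  have h1 := hdetm g hg
  rw [h, hneg] at h1
  rw [hm]
  exact (even_of_neg_one_pow_eq_one h1.symm).mul_right _

theorem commute_of_mem (hpair : IsDualPair G G') {g g' : orthogonalGroup b} (hg : g ∈ G)
    (hg' : g' ∈ G') : Commute g.1 g'.1 := by
  rw [← hpair.2] at hg'
  exact congrArg Subtype.val (Subgroup.mem_centralizer_iff.1 hg' g hg)

/-- In odd dimension, the lifts of `-1` are central. -/
theorem exists_central_lift_neg (hb : b.IsSymm) (hnd : b.Nondegenerate)
    (hodd : Odd (Module.finrank K E)) :
    ∃ z : (CliffordAlgebra (halfQuadraticForm b))ˣ, Lifts b z (LinearEquiv.neg K) ∧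
      ∀ y, Commute z y := by
  obtain ⟨k, z, hz⟩ :=
    exists_isVectorProductLift_top hb hnd (LinearEquiv.neg K) neg_mem_orthogonalGroup
  have hk : (-1 : K) ^ k = -1 := by
    rw [← hz.det, det_of_forall_eq_neg _ fun x => rfl, hodd.neg_one_pow]
  refine ⟨z, hz.lifts, fun y => Units.ext ?_⟩
  change (z : CliffordAlgebra (halfQuadraticForm b)) * y = y * z
  induction (y : CliffordAlgebra (halfQuadraticForm b)) using CliffordAlgebra.induction with
  | algebraMap r => rw [Algebra.commutes]
  | ι e =>
    have h := hz.lifts e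
    rwa [hz.involute_eq, hk, neg_one_smul, LinearEquiv.neg_apply, map_neg, neg_mul, neg_mul,
      neg_inj] at h
  | mul x y hx hy => rw [← mul_assoc, hx, mul_assoc, hy, mul_assoc]
  | add x y hx hy => rw [mul_add, add_mul, hx, hy]

theorem commute_lifts_of_dualPair (hb : b.IsSymm) (hnd : b.Nondegenerate)
    (hK : ∀ (N : Submodule K E) (T A : Module.End K N), Commute T A → LinearMap.det A = -1 →
      ∀ p : Polynomial K, Irreducible p → Polynomial.aeval T p = 0 → ∃ c : K, T = c • 1)
    (hpair : IsIrreducibleReductiveDualPair G G')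
    (h : ¬ IsOrthogonalPair G G' ∨ Odd (Module.finrank K E))
    {g g' : orthogonalGroup b} (hg : g ∈ G) (hg' : g' ∈ G')
    {x y : (CliffordAlgebra (halfQuadraticForm b))ˣ} (hx : Lifts b x g.1) (hy : Lifts b y g'.1) :
    Commute x y := by
  have key : ∀ {g : orthogonalGroup b} (_ : g ∈ G)
      {x : (CliffordAlgebra (halfQuadraticForm b))ˣ} (_ : Lifts b x g.1),
      (¬ IsOrthogonalPair G G' ∨
        (LinearMap.det g.1.toLinearMap = 1 ∧ Odd (Module.finrank K E))) → Commute x y := by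
    intro g hg x hx h
    refine commute_of_det_eq_one hb hnd g.2 g'.2 (commute_of_mem hpair.1.1 hg hg')
      (fun N hN hNd hNinv => ?_) hx hy
    by_contra hdet
    have hN' : IsInvariant (MonoidHom.id _) G N := fun k hk u hu =>
      hNinv k.1 (commute_of_mem hpair.1.1 hk hg') u hu
    obtain ⟨h1, h2⟩ := isOrthogonalPair_of_det_ne_one hb hnd hK hpair hg N hN' hNd hdet
    rcases h with h | ⟨h, hodd⟩
    · exact h h1
    · exact Nat.not_even_iff_odd.2 hodd (h2 h)
  rcases h with h | hodd
  · exact key hg hx (Or.inl h)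
  by_cases hdet : LinearMap.det g.1.toLinearMap = 1
  · exact key hg hx (Or.inr ⟨hdet, hodd⟩)
  -- In odd dimension `-g` has determinant `1`, and its lifts differ from those of `g` by a central
  -- element.
  obtain ⟨z, hz, hzc⟩ := exists_central_lift_neg hb hnd hodd
  have hneg : LinearMap.det g.1.toLinearMap = -1 :=
    (mul_self_eq_one_iff.1 (det_mul_det_of_pairing b hnd.1 hnd.2 _ _
      fun x y => g.2 x y)).resolve_left hdet
  let n : orthogonalGroup b := ⟨LinearEquiv.neg K, neg_mem_orthogonalGroup⟩
  have hn : n ∈ G := by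
    rw [← hpair.1.1.1]
    exact Subgroup.mem_centralizer_iff.2 fun k _ => Subtype.ext (LinearEquiv.ext fun e =>
      map_neg k.1 e)
  have h1 : Commute (z * x) y := by
    refine key (g := n * g) (mul_mem hn hg) (hz.mul hx) (Or.inr ⟨?_, hodd⟩)
    change LinearMap.det ((LinearEquiv.neg K : E ≃ₗ[K] E).toLinearMap ∘ₗ g.1.toLinearMap) = 1
    rw [LinearMap.det_comp, hneg, det_of_forall_eq_neg _ fun x => rfl, hodd.neg_one_pow]
    norm_num
  have h2 := (hzc y).inv_left.mul_left h1
  rwa [inv_mul_cancel_left] at h2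

theorem lifts_pinProj (hb : b.IsSymm) {S : Subgroup Kˣ} (x : pin b S) :
    Lifts b x.1 (pinProj b hb S x).1 := fun e => by
  have h : ι (halfQuadraticForm b) ((pinProj b hb S x).1 e) = _ := ι_pinAct b S x e
  rw [h, mul_assoc, Units.inv_mul, mul_one]

/-- The projection from the Pin group is onto if the norms in `S` meet every square class. -/
theorem pinProj_surjective (hb : b.IsSymm) (hnd : b.Nondegenerate) {S : Subgroup Kˣ}
    (hS : ∀ a : Kˣ, ∃ c : Kˣ, c * c * a ∈ S) : Function.Surjective (pinProj b hb S) := by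
  rintro ⟨g, hg⟩
  obtain ⟨k, x, hx⟩ := exists_isVectorProductLift_top hb hnd g hg
  obtain ⟨a, ha⟩ := hx.norm
  obtain ⟨c, hc⟩ := hS a
  let c' : (CliffordAlgebra (halfQuadraticForm b))ˣ :=
    Units.map (algebraMap K (CliffordAlgebra (halfQuadraticForm b))).toMonoidHom c
  have hc' : (c' : CliffordAlgebra (halfQuadraticForm b)) = algebraMap K _ (c : K) := rfl
  have hlift : Lifts b (c' * x) g := fun e => by
    rw [Units.val_mul, hc', map_mul, AlgHom.commutes, mul_assoc, hx.lifts, ← mul_assoc,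
      Algebra.commutes, mul_assoc]
  have hconj : ∀ e, involute ((c' * x : (CliffordAlgebra (halfQuadraticForm b))ˣ) :
      CliffordAlgebra (halfQuadraticForm b)) * ι _ e *
      (((c' * x)⁻¹ : (CliffordAlgebra (halfQuadraticForm b))ˣ) :
        CliffordAlgebra (halfQuadraticForm b)) = ι _ (g e) := fun e => by
    rw [hlift, mul_assoc, Units.mul_inv, mul_one]
  have hmem : c' * x ∈ pin b S := by
    refine ⟨⟨c * c * a, hc, ?_⟩, ?_⟩
    · rw [Units.val_mul, hc', map_mul, reverse.map_mul, AlgHom.commutes, reverse.commutes,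
        mul_assoc, ← mul_assoc (x : CliffordAlgebra (halfQuadraticForm b)), ha, ← map_mul,
        ← map_mul, Units.val_mul, Units.val_mul]
      congr 1
      ring
    · rw [← Set.range_comp]
      ext z
      constructor
      · rintro ⟨e, rfl⟩
        exact ⟨g e, (hconj e).symm⟩
      · rintro ⟨e, rfl⟩
        exact ⟨g.symm e, (hconj _).trans (by rw [g.apply_symm_apply])⟩
  refine ⟨⟨c' * x, hmem⟩,
    Subtype.ext (LinearEquiv.ext fun e => ι_injective (halfQuadraticForm b) ?_)⟩
  exact (ι_pinAct b S ⟨c' * x, hmem⟩ e).trans (hconj e)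

/-- The preimages in the Pin group of a dual pair form a dual pair as soon as they commute. -/
theorem isIrreducibleDualPair_comap {Γ : Type*} [Group Γ] {ρ : Γ →* orthogonalGroup b}
    (hρ : Function.Surjective ρ) (hpair : IsIrreducibleDualPair (MonoidHom.id _) G G')
    (hcomm : ∀ x ∈ G.comap ρ, ∀ y ∈ G'.comap ρ, Commute x y) :
    IsIrreducibleDualPair ρ (G.comap ρ) (G'.comap ρ) := by
  refine ⟨⟨le_antisymm (fun x hx => ?_) fun x hx => ?_,
      le_antisymm (fun y hy => ?_) fun y hy => ?_⟩,
    fun E₁ E₂ hc horth h1 h1' h2 h2' => hpair.2 E₁ E₂ hc horth ?_ ?_ ?_ ?_⟩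
  · rw [Subgroup.mem_comap, ← hpair.1.1]
    refine Subgroup.mem_centralizer_iff.2 fun g' hg' => ?_
    obtain ⟨y, rfl⟩ := hρ g'
    rw [← map_mul, ← map_mul, Subgroup.mem_centralizer_iff.1 hx y hg']
  · exact Subgroup.mem_centralizer_iff.2 fun y hy => (hcomm x hx y hy).eq.symm
  · rw [Subgroup.mem_comap, ← hpair.1.2]
    refine Subgroup.mem_centralizer_iff.2 fun g hg => ?_
    obtain ⟨x, rfl⟩ := hρ g
    rw [← map_mul, ← map_mul, Subgroup.mem_centralizer_iff.1 hy x hg]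
  · exact Subgroup.mem_centralizer_iff.2 fun x hx => (hcomm x hx y hy).eq
  all_goals
    intro g hg u hu
    obtain ⟨x, rfl⟩ := hρ g
    first
    | exact h1 x hg u hu
    | exact h1' x hg u hu
    | exact h2 x hg u hu
    | exact h2' x hg u hu

theorem isIrreducibleDualPair_comap_pinProj (hb : b.IsSymm) (hnd : b.Nondegenerate)
    {S : Subgroup Kˣ} (hS : ∀ a : Kˣ, ∃ c : Kˣ, c * c * a ∈ S)
    (hK : ∀ (N : Submodule K E) (T A : Module.End K N), Commute T A → LinearMap.det A = -1 →
      ∀ p : Polynomial K, Irreducible p → Polynomial.aeval T p = 0 → ∃ c : K, T = c • 1)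
    (hpair : IsIrreducibleReductiveDualPair G G')
    (h : ¬ IsOrthogonalPair G G' ∨ Odd (Module.finrank K E)) :
    IsIrreducibleDualPair (pinProj b hb S) (G.comap (pinProj b hb S))
      (G'.comap (pinProj b hb S)) :=
  isIrreducibleDualPair_comap (pinProj_surjective hb hnd hS) hpair.1 fun x hx y hy =>
    Subtype.ext (commute_lifts_of_dualPair hb hnd hK hpair h hx hy (lifts_pinProj hb x)
      (lifts_pinProj hb y)).eq

theorem exists_mul_mem_realNorms (a : ℝˣ) : ∃ c : ℝˣ, c * c * a ∈ realNorms := by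
  have ha : 0 < |(a : ℝ)| := abs_pos.2 a.ne_zero
  refine ⟨Units.mk0 (Real.sqrt |(a : ℝ)|)⁻¹ (inv_ne_zero (Real.sqrt_pos.2 ha).ne'), ?_⟩
  have hs : (Real.sqrt |(a : ℝ)|)⁻¹ * (Real.sqrt |(a : ℝ)|)⁻¹ = |(a : ℝ)|⁻¹ := by
    rw [← mul_inv, Real.mul_self_sqrt ha.le]
  rcases abs_choice (a : ℝ) with h | h
  · refine ⟨0, Units.ext ?_⟩
    simp only [zpow_zero, Units.val_one, Units.val_mul, Units.val_mk0]
    rw [hs, h, inv_mul_cancel₀ a.ne_zero]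
  · refine ⟨1, Units.ext ?_⟩
    simp only [zpow_one, Units.val_neg, Units.val_one, Units.val_mul, Units.val_mk0]
    rw [hs, h, inv_neg, neg_mul, inv_mul_cancel₀ a.ne_zero]

theorem exists_mul_mem_complexNorms (a : ℂˣ) : ∃ c : ℂˣ, c * c * a ∈ complexNorms := by
  obtain ⟨z, hz⟩ := IsAlgClosed.exists_pow_nat_eq ((a⁻¹ : ℂˣ) : ℂ) two_pos
  have hz0 : z ≠ 0 := by
    rintro rfl
    rw [zero_pow two_ne_zero] at hz
    exact a⁻¹.ne_zero hz.symm
  refine ⟨Units.mk0 z hz0, Subgroup.mem_bot.2 (Units.ext ?_)⟩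
  rw [Units.val_mul, Units.val_mul, Units.val_mk0, ← pow_two, hz, Units.inv_mul, Units.val_one]

end CommutingPreimages

end PinDualPair

open PinDualPair in
theorem theorem1p1 :
    (∀ (E : Type*) [AddCommGroup E] [Module ℝ E] [FiniteDimensional ℝ E]
      (b : LinearMap.BilinForm ℝ E) (hb : b.IsSymm) (_ : b.Nondegenerate)
      (G G' : Subgroup (orthogonalGroup b)),
      IsIrreducibleReductiveDualPair G G' → ¬ IsOrthogonalPair G G' →
      IsIrreducibleDualPair (pinProj b hb realNorms)
        (G.comap (pinProj b hb realNorms)) (G'.comap (pinProj b hb realNorms))) ∧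
    (∀ (E : Type*) [AddCommGroup E] [Module ℂ E] [FiniteDimensional ℂ E]
      (b : LinearMap.BilinForm ℂ E) (hb : b.IsSymm) (_ : b.Nondegenerate)
      (G G' : Subgroup (orthogonalGroup b)),
      IsIrreducibleReductiveDualPair G G' →
      (¬ IsOrthogonalPair G G' ∨ Odd (Module.finrank ℂ E)) →
      IsIrreducibleDualPair (pinProj b hb complexNorms)
        (G.comap (pinProj b hb complexNorms)) (G'.comap (pinProj b hb complexNorms))) := by
  refine ⟨fun E _ _ _ b hb hnd G G' hpair h => ?_, fun E _ _ _ b hb hnd G G' hpair h => ?_⟩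
  · refine isIrreducibleDualPair_comap_pinProj hb hnd exists_mul_mem_realNorms
      (fun N T A hTA hA p hp hpT => ?_) hpair (Or.inl h)
    exact eq_smul_one_of_aeval_real hTA (by rw [hA]; norm_num) hp hpT
  · exact isIrreducibleDualPair_comap_pinProj hb hnd exists_mul_mem_complexNorms
      (fun N T A _ _ p hp hpT => eq_smul_one_of_aeval_of_isAlgClosed hp hpT) hpair h
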